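/- Let $H$ be a separable (infinite-dimensional, complex) Hilbert space and let $A$ be a positive self-adjoint operator in $H$ with compact inverse. Let $\{e_n\}_{n\ge1}$ be an orthonormal basis of eigenvectors, $Ae_n=a_ne_n$, with $1\le a_1\le a_2\le\cdots$ and $a_n\to+\infty$. Let $c_k>0$ and $0<\gamma_1<\gamma_2<\cdots$, $\gamma_k\to+\infty$, satisfy $$\sum_{k\ge1}\frac{c_k}{\gamma_k}<1,\qquad \sum_{k\ge1}c_k<+\infty,\qquad \sup_{k}\gamma_k(\gamma_{k+1}-\gamma_k)=+\infty .$$ Let $\theta\in[0,1]$ and put, for $\lambda\in\mathbb C\setminus\{-\gamma_k\}_{k\ge1}$, $$\widehat K(\lambda)=\sum_{k\ge1}\frac{c_k}{\lambda+\gamma_k},\qquad L(\lambda)=\lambda^2I+A^2-\widehat K(\lambda)A^{2\theta}\ \text{ on } \operatorname{dom}(A^2),$$ $$\ell_n(\lambda)=(L(\lambda)e_n,e_n)=\lambda^2+a_n^2\Bigl(1-\frac{1}{a_n^{2(1-\theta)}}\widehat K(\lambda)\Bigr).$$ The resolvent set of $L$ is the set of points at which the operator-valued function $L^{-1}$ exists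 and is bounded: a point $\lambda\ne-\gamma_k$ belongs to it if $L(\lambda)$ has an everywhere defined bounded inverse; a pole $-\gamma_k$ of $\widehat K$ belongs to it if $L^{-1}$ exists and is uniformly bounded on a punctured neighbourhood of $-\gamma_k$ (so that the singularity of $L^{-1}$ there is removable). The spectrum $\sigma(L)$ is the complement of the resolvent set in $\mathbb C$. Then there are real numbers $\lambda_{n,k}(\theta)$ $(n,k\ge1)$ and complex numbers $\lambda_n^{\pm}(\theta)$ $(n\ge1)$ such that, for every $n$, the set of zeros of the meromorphic function $\ell_n$ is $\{\lambda_{n,k}(\theta)\}_{k\ge1}\cup\{\lambda_n^{+}(\theta),\lambda_n^{-}(\theta)\}$, where $$\cdots<-\gamma_k<\lambda_{n,k}(\theta)<-\gamma_{k-1}<\cdots<-\gamma_1<\lambda_{n,1}(\theta)<0,$$ where $\lim_{n\to\infty}\lambda_{n,k}(\theta)=-\gamma_k$ for every $k$ if $\theta<1$, and where, for all sufficiently large $n$, $\operatorname{Im}\lambda_n^+(\theta)>0$ and $\lambda_n^-(\theta)=\overline{\lambda_n^+(\theta)}$; and $$\sigma(L)=\overline{\Bigl(\bigcup_{n=1}^\infty\bigcup_{k=1}^\infty\{\lambda_{n,k}(\theta)\}\Bigr)\cup\Bigl(\bigcup_{n=1}^\infty\{\lambda_n^{+}(\theta),\lambda_n^{-}(\theta)\}\Bigr)}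 .$$ -/

import Mathlib

open Filter Topology

noncomputable section

namespace GurtinPipkin

section Operators

variable {H : Type*} [NormedAddCommGroup H] [InnerProductSpace ℂ H] [CompleteSpace H]

/-- `S` is an everywhere defined bounded inverse of the (unbounded) operator `T`:
`T` is a bijection from its domain onto `H` and `S` is its inverse. -/
def IsBoundedInverse (T : H →ₗ.[ℂ] H) (S : H →L[ℂ] H) : Prop :=
  (∀ y : H, ∃ h : S y ∈ T.domain, T ⟨S y, h⟩ = y) ∧ ∀ x : T.domain, S (T x) = x

/-- `A` is self-adjoint and positive, and has a compact inverse. -/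
structure IsPositiveWithCompactInverse (A : H →ₗ.[ℂ] H) : Prop where
  selfAdjoint : IsSelfAdjoint A
  positive : ∀ x : A.domain, x ≠ 0 → 0 < (inner ℂ (A x) (x : H)).re
  compact_inverse : ∃ S : H →L[ℂ] H, IsBoundedInverse A S ∧ IsCompactOperator S

/-- The square `A²`, with domain `{x ∈ dom A | A x ∈ dom A}`. -/
def opSq (A : H →ₗ.[ℂ] H) : H →ₗ.[ℂ] H :=
  A.comp (A.domRestrict ((A.domain.comap A.toFun).map A.domain.subtype)) (by
    rintro ⟨x, hx⟩
    obtain ⟨⟨y, hy, rfl⟩, hA⟩ := hx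
    exact hy)

/-- The domain `{x | ∑ |a_n^s ⟨e_n, x⟩|² < ∞}` of the power `A^s`. -/
def powDomain (e : HilbertBasis ℕ ℂ H) (a : ℕ → ℝ) (s : ℝ) : Submodule ℂ H where
  carrier := {x | Memℓp (fun n => ((a n ^ s : ℝ) : ℂ) * e.repr x n) 2}
  zero_mem' := by
    have h : (fun n => ((a n ^ s : ℝ) : ℂ) * e.repr (0 : H) n) = (0 : ℕ → ℂ) := by
      funext n
      simp
    simpa only [Set.mem_ofPred_eq, h] using (zero_memℓp : Memℓp (0 : ℕ → ℂ) 2)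
  add_mem' := by
    intro x y hx hy
    have h : (fun n => ((a n ^ s : ℝ) : ℂ) * e.repr (x + y) n) =
        (fun n => ((a n ^ s : ℝ) : ℂ) * e.repr x n) +
          fun n => ((a n ^ s : ℝ) : ℂ) * e.repr y n := by
      funext n
      simp [mul_add]
    simpa only [Set.mem_ofPred_eq, h] using Memℓp.add hx hy
  smul_mem' := by
    intro c x hx
    have h : (fun n => ((a n ^ s : ℝ) : ℂ) * e.repr (c • x) n) =
        c • fun n => ((a n ^ s : ℝ) : ℂ) * e.repr x n := by
      funext n
      simp [mul_left_comm]
    simpa only [Set.mem_ofPred_eq, h] using Memℓp.const_smul hx c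

/-- The power `A^s x = ∑ a_n^s ⟨e_n, x⟩ e_n` of the operator with orthonormal eigenbasis `e`
and positive eigenvalues `a n`. -/
def opPow (e : HilbertBasis ℕ ℂ H) (a : ℕ → ℝ) (s : ℝ) : H →ₗ.[ℂ] H where
  domain := powDomain e a s
  toFun :=
    { toFun := fun x => e.repr.symm
        (⟨fun n => ((a n ^ s : ℝ) : ℂ) * e.repr (x : H) n, x.2⟩ : lp (fun _ : ℕ => ℂ) 2)
      map_add' := by
        intro x y
        apply e.repr.injective
        rw [map_add]
        simp only [LinearIsometryEquiv.apply_symm_apply]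
        apply Subtype.ext
        funext n
        simp only [AddSubgroup.coe_add, PreLp.add_apply, Submodule.coe_add, map_add]
        simp only [mul_add]
        rfl
      map_smul' := by
        intro c x
        apply e.repr.injective
        rw [RingHom.id_apply, map_smul]
        simp only [LinearIsometryEquiv.apply_symm_apply]
        apply Subtype.ext
        funext n
        simp only [Submodule.coe_smul, map_smul]
        simp [mul_left_comm] }

/-- The Laplace transform `K̂(z) = ∑ c_k / (z + γ_k)` of `K(t) = ∑ c_k exp (-γ_k t)`,
meaningful at every `z` that is not a pole. -/
def laplaceK (c γ : ℕ → ℝ) (z : ℂ) : ℂ := ∑' k, (c k : ℂ) / (z + (γ k : ℂ))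

/-- The set `{-γ_k}` of poles of `K̂`. -/
def poles (γ : ℕ → ℝ) : Set ℂ := Set.range fun k => (-(γ k) : ℂ)

/-- The operator-valued function `L(z) = z² I + A² - K̂(z) A^{2θ}`, for `z` not a pole of `K̂`. -/
def symbolL (A : H →ₗ.[ℂ] H) (e : HilbertBasis ℕ ℂ H) (a c γ : ℕ → ℝ) (θ : ℝ) (z : ℂ) :
    H →ₗ.[ℂ] H :=
  z ^ 2 • (LinearMap.id : H →ₗ[ℂ] H).toPMap ⊤ + opSq A - laplaceK c γ z • opPow e a (2 * θ)

/-- The points at which the operator-valued function `L⁻¹` exists and is bounded. At a point that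
is not a pole of `K̂` this says that `L(z)` has a bounded inverse. At a pole, where `L` itself has
no value, it says that `L⁻¹` exists and is bounded on a punctured neighbourhood
(the singularity of `L⁻¹` is removable). -/
def resolventSetL (A : H →ₗ.[ℂ] H) (e : HilbertBasis ℕ ℂ H) (a c γ : ℕ → ℝ) (θ : ℝ) : Set ℂ :=
  {z | (z ∉ poles γ ∧ ∃ S, IsBoundedInverse (symbolL A e a c γ θ z) S) ∨
    (z ∈ poles γ ∧ ∃ C : ℝ, ∀ᶠ w in 𝓝[≠] z,
      ∃ S, IsBoundedInverse (symbolL A e a c γ θ w) S ∧ ‖S‖ ≤ C)}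

/-- The spectrum of `L`. -/
def spectrumL (A : H →ₗ.[ℂ] H) (e : HilbertBasis ℕ ℂ H) (a c γ : ℕ → ℝ) (θ : ℝ) : Set ℂ :=
  (resolventSetL A e a c γ θ)ᶜ

end Operators

/-- `ℓ_n(z) = z² + a_n² (1 - a_n^{-2(1-θ)} K̂(z))`, which is `(L(z) e_n, e_n)`. -/
def ell (a c γ : ℕ → ℝ) (θ : ℝ) (n : ℕ) (z : ℂ) : ℂ :=
  z ^ 2 + (a n : ℂ) ^ 2 * (1 - 1 / ((a n ^ (2 * (1 - θ)) : ℝ) : ℂ) * laplaceK c γ z)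

/-- The set of zeros of the meromorphic function `ℓ_n`. -/
def zerosEll (a c γ : ℕ → ℝ) (θ : ℝ) (n : ℕ) : Set ℂ :=
  {z | z ∉ poles γ ∧ ell a c γ θ n z = 0}

end GurtinPipkin

end

open Filter Topology

noncomputable section

namespace GurtinPipkin

/-! ### Sums of simple fractions -/

/-! In the eigenbasis `L(z)` is diagonal with entries `ℓ_n(z) = z² + α - β K̂(z)`, where `α = a_n²`,
`β = a_n^(2θ)` and `0 < β ≤ α`. The proof first locates the zeros of such a function and then
compares them with bounded invertibility.

Zeros. Between neighbouring poles the real function changes sign because the residues `c_k` are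
positive; in the last interval this uses `K̂(0) < 1` (`exists_mem_band_realSymbol_eq_zero`). That at
most two further zeros exist is shown by divided differences (`not_two_positivePairs`): at four
distinct zeros the third divided difference vanishes, the polynomial part contributes nothing to it,
and each fraction contributes a term of one sign as soon as the points split into two conjugate
pairs or pairs from one band. For large `a_n` a quantitative open mapping theorem gives a nonreal
zero near `i a_n` (`exists_mem_zeroSet_im_pos`).

Spectrum. Since `ℓ_n / a_n²` tends to `1` if `θ < 1` and to `1 - K̂` if `θ = 1`, a point off the
poles is in the resolvent set exactly when no `ℓ_n` vanishes there and, for `θ = 1`, `K̂ ≠ 1`.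
Solutions of `K̂ = 1` are limits of zeros. Poles are limits of zeros if `θ < 1` and resolvent points
if `θ = 1`. Conversely, a resolvent point has a neighbourhood free of zeros
(`eventually_notMem_zerosEll`). -/

theorem exists_pos_le_of_eventually {f : ℕ → ℝ} {ε : ℝ} (hε : 0 < ε)
    (hev : ∀ᶠ n in atTop, ε ≤ f n) (hpos : ∀ n, 0 < f n) : ∃ d > 0, ∀ n, d ≤ f n := by
  obtain ⟨N, hN⟩ := eventually_atTop.1 hev
  have key : ∀ N : ℕ, ∃ d > 0, ∀ n < N, d ≤ f n := by
    intro N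
    induction N with
    | zero => exact ⟨1, one_pos, fun n hn => absurd hn (Nat.not_lt_zero n)⟩
    | succ N ih =>
      obtain ⟨d, hd, h⟩ := ih
      refine ⟨min d (f N), lt_min hd (hpos N), fun n hn => ?_⟩
      rcases Nat.lt_succ_iff_lt_or_eq.1 hn with h1 | rfl
      · exact (min_le_left _ _).trans (h n h1)
      · exact min_le_right _ _
  obtain ⟨d, hd, h⟩ := key N
  refine ⟨min d ε, lt_min hd hε, fun n => ?_⟩
  rcases lt_or_ge n N with h1 | h1
  · exact (min_le_left _ _).trans (h n h1)
  · exact (min_le_right _ _).trans (hN n h1)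

theorem notMem_poles_iff {γ : ℕ → ℝ} {z : ℂ} : z ∉ poles γ ↔ ∀ k, z + (γ k : ℂ) ≠ 0 := by
  simp only [poles, Set.mem_range, not_exists, ne_eq, add_eq_zero_iff_eq_neg]
  exact forall_congr' fun k => not_congr eq_comm

/-- Only finitely many `-γ_k` lie near `z`. The predicate `P` allows indices to be ignored: with `P
k` meaning `c k ≠ 0`, a point `-γ_k` is admitted once its coefficient has been removed. -/
theorem exists_dist_le {γ : ℕ → ℝ} (hγ_lim : Tendsto γ atTop atTop) {z : ℂ} {P : ℕ → Prop}
    (h : ∀ k, P k → z + (γ k : ℂ) ≠ 0) : ∃ d > 0, ∀ k, P k → d ≤ ‖z + (γ k : ℂ)‖ := by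
  classical
  obtain ⟨d, hd, hk⟩ := exists_pos_le_of_eventually
    (f := fun k => if P k then ‖z + (γ k : ℂ)‖ else 1) one_pos
    (by
      filter_upwards [hγ_lim.eventually_ge_atTop (1 + ‖z‖)] with k hk
      split_ifs
      · have h1 := norm_sub_le (z + (γ k : ℂ)) z
        rw [add_sub_cancel_left, Complex.norm_real] at h1
        have h2 := le_abs_self (γ k)
        rw [Real.norm_eq_abs] at h1
        linarith
      · exact le_rfl)
    (by
      intro k
      split_ifs with hP
      · exact norm_pos_iff.2 (h k hP)
      · exact one_pos)
  refine ⟨d, hd, fun k hP => ?_⟩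
  simpa [hP] using hk k

theorem eventually_notMem_poles {γ : ℕ → ℝ} (hγ_lim : Tendsto γ atTop atTop) {z : ℂ} {P : ℕ → Prop}
    (h : ∀ k, P k → z + (γ k : ℂ) ≠ 0) : ∀ᶠ w in 𝓝 z, ∀ k, P k → w + (γ k : ℂ) ≠ 0 := by
  obtain ⟨d, hd, hk⟩ := exists_dist_le hγ_lim h
  filter_upwards [Metric.ball_mem_nhds z hd] with w hw k hP h0
  have h1 := hk k hP
  have : z + (γ k : ℂ) = z - w := by linear_combination h0
  rw [this, ← dist_eq_norm, dist_comm] at h1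
  exact absurd (Metric.mem_ball.1 hw) (not_lt.2 h1)

theorem norm_div_le_of_dist {c : ℝ} (hc : 0 ≤ c) {d : ℝ} (hd : 0 < d) {w : ℂ}
    (h : c ≠ 0 → d ≤ ‖w‖) : ‖(c : ℂ) / w‖ ≤ c / d := by
  rw [norm_div, Complex.norm_of_nonneg hc]
  rcases eq_or_ne c 0 with h0 | h0
  · simp [h0]
  · exact div_le_div_of_nonneg_left hc hd (h h0)

theorem differentiableAt_laplaceK {c γ : ℕ → ℝ} (hc0 : ∀ k, 0 ≤ c k) (hcs : Summable c)
    (hγ_lim : Tendsto γ atTop atTop) {z : ℂ} (h : ∀ k, c k ≠ 0 → z + (γ k : ℂ) ≠ 0) :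
    DifferentiableAt ℂ (laplaceK c γ) z := by
  obtain ⟨d, hd, hk⟩ := exists_dist_le hγ_lim h
  have hw : ∀ k, ∀ w ∈ Metric.ball z (d / 2), c k ≠ 0 → d / 2 ≤ ‖w + (γ k : ℂ)‖ := by
    intro k w hw hck
    have h1 := hk k hck
    have h2 : ‖z + (γ k : ℂ)‖ ≤ ‖z - w‖ + ‖w + (γ k : ℂ)‖ := by
      have e : z + (γ k : ℂ) = (z - w) + (w + (γ k : ℂ)) := by ring
      rw [e]
      exact norm_add_le _ _
    rw [Metric.mem_ball, dist_comm, dist_eq_norm] at hw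
    linarith
  have := Complex.differentiableOn_tsum_of_summable_norm
    (F := fun k w => (c k : ℂ) / (w + (γ k : ℂ))) (u := fun k => c k / (d / 2))
    (U := Metric.ball z (d / 2)) (hcs.div_const _) (fun k => by
      rcases eq_or_ne (c k) 0 with h0 | h0
      · simp [h0]
      · refine DifferentiableOn.div (by fun_prop) (by fun_prop) fun w hw' h1 => ?_
        have := hw k w hw' h0
        rw [h1, norm_zero] at this
        linarith) Metric.isOpen_ball
    (fun k w hw' => norm_div_le_of_dist (hc0 k) (half_pos hd) (hw k w hw'))
  exact this.differentiableAt (Metric.ball_mem_nhds z (half_pos hd))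

/-- The sum `∑ c_k g_k / (z + γ_k)`. -/
def weightedSum (c γ : ℕ → ℝ) (g : ℕ → ℂ) (z : ℂ) : ℂ := ∑' k, (c k : ℂ) * (g k / (z + (γ k : ℂ)))

theorem weightedSum_one (c γ : ℕ → ℝ) (z : ℂ) :
    weightedSum c γ (fun _ => 1) z = laplaceK c γ z := by
  simp [weightedSum, laplaceK, div_eq_mul_inv]

theorem exists_bound_div {γ : ℕ → ℝ} (hγ_lim : Tendsto γ atTop atTop) {z : ℂ} (hz : z ∉ poles γ)
    {g : ℕ → ℂ} (hg : ∃ M, ∀ k, ‖g k‖ ≤ M) : ∃ M, ∀ k, ‖g k / (z + (γ k : ℂ))‖ ≤ M := by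
  obtain ⟨M, hM⟩ := hg
  obtain ⟨d, hd, hk⟩ := exists_dist_le (P := fun _ => True) hγ_lim
    (fun k _ => notMem_poles_iff.1 hz k)
  refine ⟨M / d, fun k => ?_⟩
  rw [norm_div]
  exact div_le_div₀ ((norm_nonneg _).trans (hM k)) (hM k) hd (hk k trivial)

theorem summable_mul_of_bound {c : ℕ → ℝ} (hc0 : ∀ k, 0 ≤ c k) (hcs : Summable c)
    {g : ℕ → ℂ} (hg : ∃ M, ∀ k, ‖g k‖ ≤ M) : Summable fun k => (c k : ℂ) * g k := by
  obtain ⟨M, hM⟩ := hg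
  refine Summable.of_norm_bounded (hcs.mul_right M) fun k => ?_
  rw [norm_mul, Complex.norm_of_nonneg (hc0 k)]
  exact mul_le_mul_of_nonneg_left (hM k) (hc0 k)

/-- Termwise this is `1/(z+γ) - 1/(w+γ) = (w-z)/((z+γ)(w+γ))`. A divided difference only inserts one
more factor into the bounded weight, so the identity can be iterated. -/
theorem weightedSum_sub {c γ : ℕ → ℝ} (hc0 : ∀ k, 0 ≤ c k) (hcs : Summable c)
    (hγ_lim : Tendsto γ atTop atTop) {z w : ℂ} (hz : z ∉ poles γ) (hw : w ∉ poles γ)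
    {g : ℕ → ℂ} (hg : ∃ M, ∀ k, ‖g k‖ ≤ M) :
    weightedSum c γ g z - weightedSum c γ g w =
      (w - z) * weightedSum c γ (fun k => g k / (z + (γ k : ℂ))) w := by
  have hgz := exists_bound_div hγ_lim hz hg
  unfold weightedSum
  rw [← (summable_mul_of_bound hc0 hcs hgz).tsum_sub
    (summable_mul_of_bound hc0 hcs (exists_bound_div hγ_lim hw hg)), ← tsum_mul_left]
  refine tsum_congr fun k => ?_
  have h1 := notMem_poles_iff.1 hz k
  have h2 := notMem_poles_iff.1 hw k
  field_simp
  ring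

/-- For every `k` the product `(x + γ_k) (y + γ_k)` is real and positive. -/
def PositivePair (γ : ℕ → ℝ) (x y : ℂ) : Prop :=
  ∀ k, ∃ r : ℝ, 0 < r ∧ (x + (γ k : ℂ)) * (y + (γ k : ℂ)) = (r : ℂ)

theorem exists_tsum_eq_pos {c : ℕ → ℝ} (hc : ∀ k, 0 < c k) (hcs : Summable c)
    {g : ℕ → ℂ} (hg : ∃ M, ∀ k, ‖g k‖ ≤ M) (hpos : ∀ k, ∃ r : ℝ, 0 < r ∧ g k = (r : ℂ)) :
    ∃ s : ℝ, 0 < s ∧ ∑' k, (c k : ℂ) * g k = (s : ℂ) := by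
  choose r hr hgr using hpos
  have h1 : (fun k => (c k : ℂ) * g k) = fun k => ((c k * r k : ℝ) : ℂ) := by
    funext k
    rw [hgr k]
    push_cast
    rfl
  have h2 := summable_mul_of_bound (fun k => (hc k).le) hcs hg
  rw [h1, Complex.summable_ofReal] at h2
  refine ⟨∑' k, c k * r k, h2.tsum_pos (fun k => (mul_pos (hc k) (hr k)).le) 0
    (mul_pos (hc 0) (hr 0)), ?_⟩
  rw [h1, Complex.ofReal_tsum]

theorem PositivePair.exists_inv {γ : ℕ → ℝ} {x y : ℂ} (h : PositivePair γ x y) (k : ℕ) :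
    ∃ r : ℝ, 0 < r ∧ 1 / (x + (γ k : ℂ)) / (y + (γ k : ℂ)) = (r : ℂ) := by
  obtain ⟨r, hr, h⟩ := h k
  refine ⟨r⁻¹, inv_pos.2 hr, ?_⟩
  rw [div_div, h]
  simp

theorem positivePair_conj {γ : ℕ → ℝ} {z : ℂ} (hz : z ∉ poles γ) :
    PositivePair γ z (starRingEnd ℂ z) := by
  intro k
  refine ⟨Complex.normSq (z + (γ k : ℂ)), Complex.normSq_pos.2 (notMem_poles_iff.1 hz k), ?_⟩
  rw [← Complex.mul_conj]
  simp

/-- The differences of `K̂` along a positive pair. -/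
theorem laplaceK_sub_of_positivePair {c γ : ℕ → ℝ} (hc : ∀ k, 0 < c k) (hcs : Summable c)
    (hγ_lim : Tendsto γ atTop atTop) {z w : ℂ} (hz : z ∉ poles γ) (hw : w ∉ poles γ)
    (h : PositivePair γ z w) :
    ∃ s : ℝ, 0 < s ∧ laplaceK c γ z - laplaceK c γ w = (w - z) * s := by
  have h1 : ∃ M, ∀ k : ℕ, ‖(fun _ => 1 : ℕ → ℂ) k‖ ≤ M := ⟨1, fun k => by simp⟩
  obtain ⟨s, hs, hsum⟩ := exists_tsum_eq_pos hc hcs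
    (exists_bound_div hγ_lim hw (exists_bound_div hγ_lim hz h1)) h.exists_inv
  refine ⟨s, hs, ?_⟩
  rw [← weightedSum_one, ← weightedSum_one, weightedSum_sub (fun k => (hc k).le) hcs hγ_lim hz hw h1,
    weightedSum, hsum]

/-- The function `z² + α - β K̂(z)` does not vanish at two disjoint positive pairs. -/
theorem not_two_positivePairs {c γ : ℕ → ℝ} (hc : ∀ k, 0 < c k) (hcs : Summable c)
    (hγ_lim : Tendsto γ atTop atTop) {α β : ℂ} {Z : Set ℂ}
    (hZ : ∀ z ∈ Z, z ∉ poles γ ∧ z ^ 2 + α - β * laplaceK c γ z = 0) {x y v t : ℂ}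
    (hx : x ∈ Z) (hy : y ∈ Z) (hv : v ∈ Z) (ht : t ∈ Z)
    (hxy : x ≠ y) (hxv : x ≠ v) (hxt : x ≠ t) (hyv : y ≠ v) (hyt : y ≠ t) (hvt : v ≠ t)
    (h1 : PositivePair γ x y) (h2 : PositivePair γ v t) : False := by
  have hc0 : ∀ k, 0 ≤ c k := fun k => (hc k).le
  obtain ⟨px, ex⟩ := hZ x hx
  obtain ⟨py, ey⟩ := hZ y hy
  obtain ⟨pv, ev⟩ := hZ v hv
  obtain ⟨pt, et⟩ := hZ t ht
  have b0 : ∃ M, ∀ k : ℕ, ‖(fun _ => 1 : ℕ → ℂ) k‖ ≤ M := ⟨1, fun k => by simp⟩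
  have b1 := exists_bound_div hγ_lim px b0
  have b2 := exists_bound_div hγ_lim py b1
  have b3 := exists_bound_div hγ_lim pv b2
  have b4 := exists_bound_div hγ_lim pt b3
  -- The weight `1/((x+γ_k)(y+γ_k)(v+γ_k)(t+γ_k))` is positive, being the product of the weights of
  -- the two pairs.
  obtain ⟨s, hs, hsum⟩ := exists_tsum_eq_pos hc hcs b4 (by
    intro k
    obtain ⟨r, hr, er⟩ := h1.exists_inv k
    obtain ⟨r', hr', er'⟩ := h2.exists_inv k
    refine ⟨r * r', mul_pos hr hr', ?_⟩
    rw [Complex.ofReal_mul, ← er, ← er']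
    simp only [div_eq_mul_inv]
    ring)
  have dxy := weightedSum_sub hc0 hcs hγ_lim px py b0
  have dxv := weightedSum_sub hc0 hcs hγ_lim px pv b0
  have dxt := weightedSum_sub hc0 hcs hγ_lim px pt b0
  have dyv := weightedSum_sub hc0 hcs hγ_lim py pv b1
  have dyt := weightedSum_sub hc0 hcs hγ_lim py pt b1
  have dvt := weightedSum_sub hc0 hcs hγ_lim pv pt b2
  rw [weightedSum_one, weightedSum_one] at dxy dxv dxt
  have e4 : weightedSum c γ (fun k => 1 / (x + (γ k : ℂ)) / (y + (γ k : ℂ)) / (v + (γ k : ℂ))) t =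
      (s : ℂ) := hsum
  rw [e4] at dvt
  set Txy := weightedSum c γ (fun k => 1 / (x + (γ k : ℂ))) y
  set Txv := weightedSum c γ (fun k => 1 / (x + (γ k : ℂ))) v
  set Txt := weightedSum c γ (fun k => 1 / (x + (γ k : ℂ))) t
  set Uv := weightedSum c γ (fun k => 1 / (x + (γ k : ℂ)) / (y + (γ k : ℂ))) v
  set Ut := weightedSum c γ (fun k => 1 / (x + (γ k : ℂ)) / (y + (γ k : ℂ))) t
  -- First divided differences are `s1`–`s3`, second ones `s4` and `s5`. The third, `s6`, has lost
  -- the polynomial part and says `β s (t - v) = 0`, with `s > 0`; and `β ≠ 0` by `s4`.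
  have s1 : x + y = -β * Txy := by
    apply mul_left_cancel₀ (sub_ne_zero.2 hxy)
    linear_combination ex - ey + β * dxy
  have s2 : x + v = -β * Txv := by
    apply mul_left_cancel₀ (sub_ne_zero.2 hxv)
    linear_combination ex - ev + β * dxv
  have s3 : x + t = -β * Txt := by
    apply mul_left_cancel₀ (sub_ne_zero.2 hxt)
    linear_combination ex - et + β * dxt
  have s4 : 1 = β * Uv := by
    apply mul_left_cancel₀ (sub_ne_zero.2 hyv)
    linear_combination s1 - s2 - β * dyv
  have s5 : 1 = β * Ut := by
    apply mul_left_cancel₀ (sub_ne_zero.2 hyt)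
    linear_combination s1 - s3 - β * dyt
  have s6 : β * ((t - v) * s) = 0 := by
    linear_combination s5 - s4 - β * dvt
  have hs' : (s : ℂ) ≠ 0 := by exact_mod_cast hs.ne'
  have hβ : β ≠ 0 := by
    rintro rfl
    simp at s4
  exact (mul_ne_zero hβ (mul_ne_zero (sub_ne_zero.2 hvt.symm) hs')) s6

/-- The residue of `K̂` at `-γ_k` is `c_k`. -/
theorem tendsto_mul_laplaceK {c γ : ℕ → ℝ} (hc0 : ∀ k, 0 ≤ c k) (hcs : Summable c)
    (hγ_mono : StrictMono γ) (hγ_lim : Tendsto γ atTop atTop) (k : ℕ) :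
    Tendsto (fun z : ℂ => (z + (γ k : ℂ)) * laplaceK c γ z) (𝓝[≠] (-(γ k) : ℂ)) (𝓝 (c k : ℂ)) := by
  classical
  -- With the `k`-th coefficient removed, the remaining sum is analytic at `-γ_k`, so the product is
  -- `c_k + (z + γ_k) ·` (a continuous function).
  set c' := Function.update c k 0
  have hc'0 : ∀ j, 0 ≤ c' j := by
    intro j
    rcases eq_or_ne j k with rfl | hj
    · simp [c']
    · simp [c', hj, hc0 j]
  have hc's : Summable c' := by
    refine Summable.of_nonneg_of_le hc'0 (fun j => ?_) hcs
    rcases eq_or_ne j k with rfl | hj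
    · simp [c', hc0 j]
    · simp [c', hj]
  have hne : ∀ j, c' j ≠ 0 → (-(γ k) : ℂ) + (γ j : ℂ) ≠ 0 := by
    intro j hj h
    have hjk : j ≠ k := by
      rintro rfl
      simp [c'] at hj
    apply hjk
    apply hγ_mono.injective
    have : (γ j : ℂ) = γ k := by linear_combination h
    exact_mod_cast this
  have hcont := (differentiableAt_laplaceK hc'0 hc's hγ_lim hne).continuousAt
  have hlim : Tendsto (fun z : ℂ => (c k : ℂ) + (z + (γ k : ℂ)) * laplaceK c' γ z)
      (𝓝[≠] (-(γ k) : ℂ)) (𝓝 (c k : ℂ)) := by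
    have : ContinuousAt (fun z : ℂ => (c k : ℂ) + (z + (γ k : ℂ)) * laplaceK c' γ z)
        (-(γ k) : ℂ) := by fun_prop
    have h := this.tendsto.mono_left (nhdsWithin_le_nhds (s := {(-(γ k) : ℂ)}ᶜ))
    simpa using h
  refine hlim.congr' ?_
  have hev := (eventually_notMem_poles hγ_lim hne).filter_mono
    (nhdsWithin_le_nhds (s := {(-(γ k) : ℂ)}ᶜ))
  filter_upwards [hev, self_mem_nhdsWithin] with z hz hzk
  have hzk' : z + (γ k : ℂ) ≠ 0 := fun h => hzk (by
    rw [Set.mem_singleton_iff]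
    linear_combination h)
  obtain ⟨d, hd, hdk⟩ := exists_dist_le hγ_lim hz
  have hs : Summable fun j => (c' j : ℂ) / (z + (γ j : ℂ)) :=
    Summable.of_norm_bounded (hc's.div_const d)
      fun j => norm_div_le_of_dist (hc'0 j) hd (hdk j)
  have hK : laplaceK c γ z = (c k : ℂ) / (z + (γ k : ℂ)) + laplaceK c' γ z := by
    have h1 : HasSum (fun j => if j = k then (c k : ℂ) / (z + (γ k : ℂ)) else 0)
        ((c k : ℂ) / (z + (γ k : ℂ))) := hasSum_ite_eq k _
    have h2 := (h1.add hs.hasSum).tsum_eq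
    rw [laplaceK, laplaceK, ← h2]
    refine tsum_congr fun j => ?_
    rcases eq_or_ne j k with rfl | hj
    · simp [c']
    · simp [c', hj]
  rw [hK]
  field_simp

/-! ### Zeros of `z² + α - β K̂(z)` -/

theorem laplaceK_ofReal (c γ : ℕ → ℝ) (x : ℝ) :
    laplaceK c γ (x : ℂ) = ((∑' k, c k / (x + γ k) : ℝ) : ℂ) := by
  rw [laplaceK, Complex.ofReal_tsum]
  push_cast
  rfl

theorem laplaceK_conj (c γ : ℕ → ℝ) (z : ℂ) :
    laplaceK c γ (starRingEnd ℂ z) = starRingEnd ℂ (laplaceK c γ z) := by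
  rw [laplaceK, laplaceK, Complex.conj_tsum]
  simp

theorem conj_notMem_poles {γ : ℕ → ℝ} {z : ℂ} (hz : z ∉ poles γ) :
    starRingEnd ℂ z ∉ poles γ := by
  rw [notMem_poles_iff] at hz ⊢
  intro k h
  apply hz k
  apply (starRingEnd ℂ).injective
  simpa using h

/-- The interval `(-γ_k, -γ_{k-1})`, respectively `(-γ_0, 0)` if `k = 0`. -/
def band (γ : ℕ → ℝ) (k : ℕ) : Set ℝ := {x | -γ k < x ∧ x < 0 ∧ ∀ j < k, x < -γ j}

theorem band_add_neg {γ : ℕ → ℝ} {k : ℕ} {x : ℝ} (hx : x ∈ band γ k) {j : ℕ} (hj : j < k) :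
    x + γ j < 0 := by
  have := hx.2.2 j hj
  linarith

theorem band_add_pos {γ : ℕ → ℝ} (hγ_mono : StrictMono γ) {k : ℕ} {x : ℝ} (hx : x ∈ band γ k)
    {j : ℕ} (hj : k ≤ j) : 0 < x + γ j := by
  have := hx.1
  have := hγ_mono.monotone hj
  linarith

theorem ofReal_notMem_poles_iff {γ : ℕ → ℝ} {x : ℝ} :
    (x : ℂ) ∉ poles γ ↔ ∀ k, x + γ k ≠ 0 := by
  rw [notMem_poles_iff]
  norm_cast

theorem notMem_poles_of_mem_band {γ : ℕ → ℝ} (hγ_mono : StrictMono γ) {k : ℕ} {x : ℝ}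
    (hx : x ∈ band γ k) : (x : ℂ) ∉ poles γ := by
  rw [ofReal_notMem_poles_iff]
  intro j
  rcases lt_or_ge j k with hj | hj
  · exact (band_add_neg hx hj).ne
  · exact (band_add_pos hγ_mono hx hj).ne'

theorem positivePair_ofReal {γ : ℕ → ℝ} {x y : ℝ} (h : ∀ k, 0 < (x + γ k) * (y + γ k)) :
    PositivePair γ (x : ℂ) (y : ℂ) :=
  fun k => ⟨_, h k, by push_cast; rfl⟩

theorem positivePair_of_mem_band {γ : ℕ → ℝ} (hγ_mono : StrictMono γ) {k : ℕ} {x y : ℝ}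
    (hx : x ∈ band γ k) (hy : y ∈ band γ k) : PositivePair γ (x : ℂ) (y : ℂ) := by
  refine positivePair_ofReal fun j => ?_
  rcases lt_or_ge j k with hj | hj
  · exact mul_pos_of_neg_of_neg (band_add_neg hx hj) (band_add_neg hy hj)
  · exact mul_pos (band_add_pos hγ_mono hx hj) (band_add_pos hγ_mono hy hj)

theorem exists_mem_band {γ : ℕ → ℝ} (hγ_lim : Tendsto γ atTop atTop) {x : ℝ} (hx0 : x < 0)
    (hx : (x : ℂ) ∉ poles γ) : ∃ k, x ∈ band γ k := by
  classical
  have hex : ∃ k, -γ k < x := by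
    obtain ⟨k, hk⟩ := (hγ_lim.eventually_gt_atTop (-x)).exists
    exact ⟨k, by linarith⟩
  refine ⟨Nat.find hex, Nat.find_spec hex, hx0, fun j hj => ?_⟩
  have h1 := Nat.find_min hex hj
  have h2 := ofReal_notMem_poles_iff.1 hx j
  exact lt_of_le_of_ne (not_lt.1 h1) fun h => h2 (by linarith)

theorem band_ordConnected (γ : ℕ → ℝ) (k : ℕ) : (band γ k).OrdConnected :=
  ⟨fun _ hx _ hy _ hz => ⟨hx.1.trans_le hz.1, hz.2.trans_lt hy.2.1,
    fun j hj => hz.2.trans_lt (hy.2.2 j hj)⟩⟩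

theorem eventually_mem_band_right {γ : ℕ → ℝ} (hγ_pos : ∀ k, 0 < γ k) (hγ_mono : StrictMono γ)
    (k : ℕ) : ∀ᶠ x in 𝓝[>] (-γ k), x ∈ band γ k := by
  cases k with
  | zero =>
    filter_upwards [Ioo_mem_nhdsGT (neg_lt_zero.2 (hγ_pos 0))] with x hx
    exact ⟨hx.1, hx.2, fun j hj => absurd hj (Nat.not_lt_zero j)⟩
  | succ k =>
    filter_upwards [Ioo_mem_nhdsGT (neg_lt_neg (hγ_mono k.lt_succ_self))] with x hx
    refine ⟨hx.1, hx.2.trans (neg_lt_zero.2 (hγ_pos k)), fun j hj => hx.2.trans_le ?_⟩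
    exact neg_le_neg (hγ_mono.monotone (Nat.lt_succ_iff.1 hj))

theorem eventually_mem_band_left {γ : ℕ → ℝ} (hγ_pos : ∀ k, 0 < γ k) (hγ_mono : StrictMono γ)
    (k : ℕ) : ∀ᶠ x in 𝓝[<] (-γ k), x ∈ band γ (k + 1) := by
  filter_upwards [Ioo_mem_nhdsLT (neg_lt_neg (hγ_mono k.lt_succ_self))] with x hx
  refine ⟨hx.1, hx.2.trans (neg_lt_zero.2 (hγ_pos k)), fun j hj => hx.2.trans_le ?_⟩
  exact neg_le_neg (hγ_mono.monotone (Nat.lt_succ_iff.1 hj))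

theorem eventually_mem_band_zero {γ : ℕ → ℝ} (hγ_pos : ∀ k, 0 < γ k) :
    ∀ᶠ x in 𝓝[<] (0 : ℝ), x ∈ band γ 0 := by
  filter_upwards [Ioo_mem_nhdsLT (neg_lt_zero.2 (hγ_pos 0))] with x hx
  exact ⟨hx.1, hx.2, fun j hj => absurd hj (Nat.not_lt_zero j)⟩

theorem ofReal_notMem_poles_of_nonneg {γ : ℕ → ℝ} (hγ_pos : ∀ k, 0 < γ k) {x : ℝ} (hx : 0 ≤ x) :
    (x : ℂ) ∉ poles γ :=
  ofReal_notMem_poles_iff.2 fun k => (add_pos_of_nonneg_of_pos hx (hγ_pos k)).ne'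

theorem tsum_div_lt_one {c γ : ℕ → ℝ} (hc : ∀ k, 0 < c k) (hγ_pos : ∀ k, 0 < γ k)
    (hs : Summable fun k => c k / γ k) (h1 : ∑' k, c k / γ k < 1) {x : ℝ} (hx : 0 ≤ x) :
    ∑' k, c k / (x + γ k) < 1 := by
  have hle : ∀ k, c k / (x + γ k) ≤ c k / γ k := fun k =>
    div_le_div_of_nonneg_left (hc k).le (hγ_pos k) (by linarith)
  exact (Summable.tsum_le_tsum hle (Summable.of_nonneg_of_le (fun k =>
    div_nonneg (hc k).le (add_nonneg hx (hγ_pos k).le)) hle hs) hs).trans_lt h1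

/-- The set of zeros of `z² + α - β K̂(z)`. -/
def zeroSet (c γ : ℕ → ℝ) (α β : ℝ) : Set ℂ :=
  {z | z ∉ poles γ ∧ z ^ 2 + (α : ℂ) - (β : ℂ) * laplaceK c γ z = 0}

/-- The restriction of `z² + α - β K̂(z)` to the real axis. -/
def realSymbol (c γ : ℕ → ℝ) (α β x : ℝ) : ℝ := x ^ 2 + α - β * ∑' k, c k / (x + γ k)

theorem ofReal_realSymbol (c γ : ℕ → ℝ) (α β x : ℝ) :
    (x : ℂ) ^ 2 + (α : ℂ) - (β : ℂ) * laplaceK c γ x = (realSymbol c γ α β x : ℂ) := by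
  rw [laplaceK_ofReal, realSymbol]
  push_cast
  rfl

theorem ofReal_mem_zeroSet_iff {c γ : ℕ → ℝ} {α β x : ℝ} :
    (x : ℂ) ∈ zeroSet c γ α β ↔ (x : ℂ) ∉ poles γ ∧ realSymbol c γ α β x = 0 := by
  rw [zeroSet, Set.mem_ofPred_eq, ofReal_realSymbol, Complex.ofReal_eq_zero]

theorem conj_mem_zeroSet {c γ : ℕ → ℝ} {α β : ℝ} {z : ℂ} (hz : z ∈ zeroSet c γ α β) :
    starRingEnd ℂ z ∈ zeroSet c γ α β := by
  refine ⟨conj_notMem_poles hz.1, ?_⟩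
  have := congrArg (starRingEnd ℂ) hz.2
  rw [laplaceK_conj]
  simpa using this

theorem continuousAt_realSymbol {c γ : ℕ → ℝ} (hc0 : ∀ k, 0 ≤ c k) (hcs : Summable c)
    (hγ_lim : Tendsto γ atTop atTop) (α β : ℝ) {x : ℝ} (hx : (x : ℂ) ∉ poles γ) :
    ContinuousAt (realSymbol c γ α β) x := by
  have hK := (differentiableAt_laplaceK hc0 hcs hγ_lim
    (fun k _ => notMem_poles_iff.1 hx k)).continuousAt
  have h1 : ContinuousAt (fun y : ℝ => laplaceK c γ (y : ℂ)) x :=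
    ContinuousAt.comp (f := fun y : ℝ => (y : ℂ)) hK Complex.continuous_ofReal.continuousAt
  have h2 : realSymbol c γ α β = fun y : ℝ => y ^ 2 + α - β * (laplaceK c γ (y : ℂ)).re := by
    funext y
    rw [laplaceK_ofReal, Complex.ofReal_re, realSymbol]
  rw [h2]
  have h3 : ContinuousAt (fun y : ℝ => (laplaceK c γ (y : ℂ)).re) x :=
    Complex.continuous_re.continuousAt.comp h1
  fun_prop

theorem realSymbol_pos_of_nonneg {c γ : ℕ → ℝ} (hc : ∀ k, 0 < c k) (hγ_pos : ∀ k, 0 < γ k)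
    (hs : Summable fun k => c k / γ k) (h1 : ∑' k, c k / γ k < 1) {α β : ℝ} (hβ : 0 < β)
    (hβα : β ≤ α) {x : ℝ} (hx : 0 ≤ x) : 0 < realSymbol c γ α β x := by
  have h := tsum_div_lt_one hc hγ_pos hs h1 hx
  unfold realSymbol
  nlinarith [sq_nonneg x]

/-- The product tends to `-β c_k < 0`. This gives both signs at once: negative to the right of the
pole, positive to the left. -/
theorem eventually_mul_realSymbol_neg {c γ : ℕ → ℝ} (hc : ∀ k, 0 < c k) (hcs : Summable c)
    (hγ_mono : StrictMono γ) (hγ_lim : Tendsto γ atTop atTop) (α : ℝ) {β : ℝ} (hβ : 0 < β)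
    (k : ℕ) : ∀ᶠ x in 𝓝[≠] (-γ k), (x + γ k) * realSymbol c γ α β x < 0 := by
  have h1 := tendsto_mul_laplaceK (fun k => (hc k).le) hcs hγ_mono hγ_lim k
  have h2 : Tendsto (fun x : ℝ => (x : ℂ)) (𝓝[≠] (-γ k)) (𝓝[≠] (-(γ k) : ℂ)) := by
    refine tendsto_nhdsWithin_iff.2 ⟨?_, ?_⟩
    · have := (Complex.continuous_ofReal.tendsto (-γ k)).mono_left
        (nhdsWithin_le_nhds (s := {-γ k}ᶜ))
      simpa using this
    · filter_upwards [self_mem_nhdsWithin] with x hx h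
      apply hx
      rw [Set.mem_singleton_iff] at h ⊢
      exact_mod_cast h
  have h3 : Tendsto (fun x : ℝ => (x + γ k) * ∑' j, c j / (x + γ j)) (𝓝[≠] (-γ k)) (𝓝 (c k)) := by
    have := (Complex.continuous_re.tendsto _).comp (h1.comp h2)
    rw [Complex.ofReal_re] at this
    refine this.congr fun x => ?_
    simp only [Function.comp_apply]
    rw [laplaceK_ofReal, ← Complex.ofReal_add, ← Complex.ofReal_mul, Complex.ofReal_re]
  have h4 : Tendsto (fun x : ℝ => (x + γ k) * (x ^ 2 + α)) (𝓝[≠] (-γ k)) (𝓝 0) := by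
    have : Continuous fun x : ℝ => (x + γ k) * (x ^ 2 + α) := by fun_prop
    have := (this.tendsto (-γ k)).mono_left (nhdsWithin_le_nhds (s := {-γ k}ᶜ))
    simpa using this
  have h5 := h4.sub (h3.const_mul β)
  have h6 : 0 - β * c k < 0 := by
    have := mul_pos hβ (hc k)
    linarith
  filter_upwards [h5.eventually_lt_const h6] with x hx
  refine lt_of_eq_of_lt ?_ hx
  rw [realSymbol]
  ring

/-- Intermediate value theorem: the function is negative near the left end of the band; near the
right end it is positive, by the next pole or, in the band ending at `0`, by `K̂(0) < 1`. -/
theorem exists_mem_band_realSymbol_eq_zero {c γ : ℕ → ℝ} (hc : ∀ k, 0 < c k) (hcs : Summable c)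
    (hγ_pos : ∀ k, 0 < γ k) (hγ_mono : StrictMono γ) (hγ_lim : Tendsto γ atTop atTop)
    (hs : Summable fun k => c k / γ k) (h1 : ∑' k, c k / γ k < 1) {α β : ℝ} (hβ : 0 < β)
    (hβα : β ≤ α) (k : ℕ) : ∃ x ∈ band γ k, realSymbol c γ α β x = 0 := by
  obtain ⟨x, hx, hfx⟩ : ∃ x ∈ band γ k, realSymbol c γ α β x < 0 := by
    have hev := (eventually_mul_realSymbol_neg hc hcs hγ_mono hγ_lim α hβ k).filter_mono
      (nhdsWithin_mono _ fun x (hx : x ∈ Set.Ioi (-γ k)) => ne_of_gt hx)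
    obtain ⟨x, h, hx⟩ := (hev.and (eventually_mem_band_right hγ_pos hγ_mono k)).exists
    exact ⟨x, hx, neg_of_mul_neg_right h (band_add_pos hγ_mono hx le_rfl).le⟩
  obtain ⟨y, hy, hfy⟩ : ∃ y ∈ band γ k, 0 < realSymbol c γ α β y := by
    cases k with
    | zero =>
      have hcont := continuousAt_realSymbol (fun k => (hc k).le) hcs hγ_lim α β
        (ofReal_notMem_poles_of_nonneg hγ_pos le_rfl)
      have hpos := realSymbol_pos_of_nonneg hc hγ_pos hs h1 hβ hβα le_rfl
      have hev := (hcont.tendsto.eventually_const_lt hpos).filter_mono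
        (nhdsWithin_le_nhds (s := Set.Iio (0 : ℝ)))
      obtain ⟨y, h, hy⟩ := (hev.and (eventually_mem_band_zero hγ_pos)).exists
      exact ⟨y, hy, h⟩
    | succ k =>
      have hev := (eventually_mul_realSymbol_neg hc hcs hγ_mono hγ_lim α hβ k).filter_mono
        (nhdsWithin_mono _ fun x (hx : x ∈ Set.Iio (-γ k)) => ne_of_lt hx)
      obtain ⟨y, h, hy⟩ := (hev.and (eventually_mem_band_left hγ_pos hγ_mono k)).exists
      exact ⟨y, hy, pos_of_mul_neg_right h (band_add_neg hy k.lt_succ_self).le⟩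
  have hcont : ContinuousOn (realSymbol c γ α β) (band γ k) := fun t ht =>
    (continuousAt_realSymbol (fun k => (hc k).le) hcs hγ_lim α β
      (notMem_poles_of_mem_band hγ_mono ht)).continuousWithinAt
  obtain ⟨t, ht, h⟩ := (band_ordConnected γ k).isPreconnected.intermediate_value hx hy hcont
    ⟨hfx.le, hfy.le⟩
  exact ⟨t, ht, h⟩

theorem exists_mem_band_of_mem_zeroSet {c γ : ℕ → ℝ} (hc : ∀ k, 0 < c k)
    (hγ_pos : ∀ k, 0 < γ k) (hγ_lim : Tendsto γ atTop atTop)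
    (hs : Summable fun k => c k / γ k) (h1 : ∑' k, c k / γ k < 1) {α β : ℝ} (hβ : 0 < β)
    (hβα : β ≤ α) {z : ℂ} (hz : z ∈ zeroSet c γ α β) (him : z.im = 0) :
    ∃ k, ∃ x ∈ band γ k, z = (x : ℂ) := by
  have e : z = (z.re : ℂ) := Complex.ext rfl (by simpa using him)
  rw [e, ofReal_mem_zeroSet_iff] at hz
  have hneg : z.re < 0 := by
    by_contra h
    exact (realSymbol_pos_of_nonneg hc hγ_pos hs h1 hβ hβα (not_lt.1 h)).ne' hz.2
  obtain ⟨k, hk⟩ := exists_mem_band hγ_lim hneg hz.1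
  exact ⟨k, z.re, hk, e⟩

/-- A set in which any three elements have two equal ones is contained in a pair. -/
theorem exists_pair_of_no_three {E : Set ℂ} {d : ℂ}
    (h3 : ∀ x ∈ E, ∀ y ∈ E, ∀ z ∈ E, x = y ∨ x = z ∨ y = z) :
    ∃ p q, p ∈ insert d E ∧ q ∈ insert d E ∧ E ⊆ {p, q} := by
  by_cases hE : ∃ p, p ∈ E
  · obtain ⟨p, hp⟩ := hE
    by_cases hq : ∃ q ∈ E, q ≠ p
    · obtain ⟨q, hq, hqp⟩ := hq
      refine ⟨p, q, Or.inr hp, Or.inr hq, fun z hz => ?_⟩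
      rcases h3 p hp q hq z hz with h | h | h
      · exact absurd h.symm hqp
      · exact Or.inl h.symm
      · exact Or.inr h.symm
    · push Not at hq
      exact ⟨p, p, Or.inr hp, Or.inr hp, fun z hz => Or.inl (hq z hz)⟩
  · push Not at hE
    exact ⟨d, d, Or.inl rfl, Or.inl rfl, fun z hz => absurd hz (hE z)⟩

/-- Away from one zero in every band, `z² + α - β K̂(z)` has at most two zeros. -/
theorem exists_zeroSet_eq {c γ : ℕ → ℝ} (hc : ∀ k, 0 < c k) (hcs : Summable c)
    (hγ_pos : ∀ k, 0 < γ k) (hγ_mono : StrictMono γ) (hγ_lim : Tendsto γ atTop atTop)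
    (hs : Summable fun k => c k / γ k) (h1 : ∑' k, c k / γ k < 1) {α β : ℝ} (hβ : 0 < β)
    (hβα : β ≤ α) :
    ∃ (lam : ℕ → ℝ) (p q : ℂ), (∀ k, lam k ∈ band γ k) ∧
      zeroSet c γ α β = (Set.range fun k => (lam k : ℂ)) ∪ {p, q} ∧
      ((∃ z ∈ zeroSet c γ α β, 0 < z.im) → 0 < p.im ∧ q = starRingEnd ℂ p) := by
  choose lam hlam hzero using fun k =>
    exists_mem_band_realSymbol_eq_zero hc hcs hγ_pos hγ_mono hγ_lim hs h1 hβ hβα k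
  have hlamZ : ∀ k, (lam k : ℂ) ∈ zeroSet c γ α β := fun k =>
    ofReal_mem_zeroSet_iff.2 ⟨notMem_poles_of_mem_band hγ_mono (hlam k), hzero k⟩
  have hno : ∀ {x y v t : ℂ}, x ∈ zeroSet c γ α β → y ∈ zeroSet c γ α β → v ∈ zeroSet c γ α β →
      t ∈ zeroSet c γ α β → x ≠ y → x ≠ v → x ≠ t → y ≠ v → y ≠ t → v ≠ t →
      PositivePair γ x y → PositivePair γ v t → False :=
    not_two_positivePairs hc hcs hγ_lim (Z := zeroSet c γ α β) (fun z hz => hz)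
  have hband : ∀ z ∈ zeroSet c γ α β, z.im = 0 → ∃ k, ∃ x ∈ band γ k, z = (x : ℂ) := fun z hz =>
    exists_mem_band_of_mem_zeroSet hc hγ_pos hγ_lim hs h1 hβ hβα hz
  set R := Set.range fun k => (lam k : ℂ) with hR
  have him_R : ∀ z ∈ R, z.im = 0 := by
    rintro _ ⟨k, rfl⟩
    simp
  have hRZ : R ⊆ zeroSet c γ α β := by
    rintro _ ⟨k, rfl⟩
    exact hlamZ k
  by_cases hex : ∃ z ∈ zeroSet c γ α β, 0 < z.im
  -- The pair `p, p̄` excludes every other disjoint positive pair. A further real zero would form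
  -- one with the chosen zero of its band, a further nonreal zero with its conjugate.
  · obtain ⟨p, hp, hpim⟩ := hex
    have hp' := conj_mem_zeroSet hp
    have hpp' : p ≠ starRingEnd ℂ p := fun h => by
      have := congrArg Complex.im h
      rw [Complex.conj_im] at this
      linarith
    have hpos := positivePair_conj hp.1
    refine ⟨lam, p, starRingEnd ℂ p, hlam, ?_, fun _ => ⟨hpim, rfl⟩⟩
    refine Set.Subset.antisymm (fun w hw => ?_) (Set.union_subset hRZ ?_)
    · by_contra hcon
      simp only [Set.mem_union, Set.mem_insert_iff, Set.mem_singleton_iff, not_or] at hcon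
      obtain ⟨hwR, hwp, hwp'⟩ := hcon
      by_cases him : w.im = 0
      · obtain ⟨k, x, hx, rfl⟩ := hband w hw him
        have hne : ∀ y : ℝ, p ≠ y ∧ starRingEnd ℂ p ≠ y := by
          intro y
          constructor <;> intro h <;> have := congrArg Complex.im h <;> simp at this <;> linarith
        exact hno hp hp' hw (hlamZ k) hpp' (hne x).1 (hne _).1 (hne x).2 (hne _).2
          (fun h => hwR ⟨k, h.symm⟩) hpos (positivePair_of_mem_band hγ_mono hx (hlam k))
      · have hww' : w ≠ starRingEnd ℂ w := fun h => by
          have := congrArg Complex.im h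
          rw [Complex.conj_im] at this
          exact him (by linarith)
        refine hno hp hp' hw (conj_mem_zeroSet hw) hpp' (Ne.symm hwp) ?_ (Ne.symm hwp') ?_ hww'
          hpos (positivePair_conj hw.1)
        · intro h
          exact hwp' (by rw [h, Complex.conj_conj])
        · intro h
          exact hwp ((starRingEnd ℂ).injective h).symm
    · rintro _ (rfl | rfl)
      · exact hp
      · exact hp'
  · have hreal : ∀ z ∈ zeroSet c γ α β, z.im = 0 := by
      intro z hz
      push Not at hex
      have h2 := hex z hz
      have h3 := hex _ (conj_mem_zeroSet hz)
      rw [Complex.conj_im] at h3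
      linarith
    -- All zeros are real. Extra zeros in different bands would each pair with the chosen zero of
    -- their band, so all lie in one band; three of them and the chosen zero would again make two
    -- pairs. If there are no extra zeros, `p` and `q` take the default value `lam 0`.
    obtain ⟨p, q, hp, hq, hE⟩ := exists_pair_of_no_three (E := zeroSet c γ α β \ R) (d := lam 0) (by
      intro x hx y hy z hz
      by_contra hcon
      push Not at hcon
      obtain ⟨hxy, hxz, hyz⟩ := hcon
      obtain ⟨i, x, hxi, rfl⟩ := hband x hx.1 (hreal x hx.1)
      obtain ⟨j, y, hyj, rfl⟩ := hband y hy.1 (hreal y hy.1)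
      obtain ⟨k, z, hzk, rfl⟩ := hband z hz.1 (hreal z hz.1)
      have hpair : ∀ {u v : ℝ} {i j : ℕ}, (u : ℂ) ∈ zeroSet c γ α β \ R →
          (v : ℂ) ∈ zeroSet c γ α β \ R → (u : ℂ) ≠ v → u ∈ band γ i → v ∈ band γ j → i = j := by
        intro u v i j hu hv huv hui hvj
        by_contra hij
        have hll : (lam i : ℂ) ≠ lam j := by
          intro h
          have h : lam i = lam j := by exact_mod_cast h
          rcases lt_or_gt_of_ne hij with h' | h'
          · have := (hlam j).2.2 i h'
            have := (hlam i).1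
            linarith
          · have := (hlam i).2.2 j h'
            have := (hlam j).1
            linarith
        exact hno hu.1 (hlamZ i) hv.1 (hlamZ j) (fun h => hu.2 ⟨i, h.symm⟩) huv
          (fun h => hu.2 ⟨j, h.symm⟩) (fun h => hv.2 ⟨i, h⟩) hll (fun h => hv.2 ⟨j, h.symm⟩)
          (positivePair_of_mem_band hγ_mono hui (hlam i))
          (positivePair_of_mem_band hγ_mono hvj (hlam j))
      obtain rfl := hpair hx hy hxy hxi hyj
      obtain rfl := hpair hx hz hxz hxi hzk
      exact hno hx.1 hy.1 hz.1 (hlamZ i) hxy hxz (fun h => hx.2 ⟨i, h.symm⟩) hyz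
        (fun h => hy.2 ⟨i, h.symm⟩) (fun h => hz.2 ⟨i, h.symm⟩)
        (positivePair_of_mem_band hγ_mono hxi hyj)
        (positivePair_of_mem_band hγ_mono hzk (hlam i)))
    refine ⟨lam, p, q, hlam, ?_, fun h => absurd h hex⟩
    have hin : insert (lam 0 : ℂ) (zeroSet c γ α β \ R) ⊆ zeroSet c γ α β :=
      Set.insert_subset (hlamZ 0) Set.sdiff_subset
    refine Set.Subset.antisymm (fun w hw => ?_) (Set.union_subset hRZ ?_)
    · by_cases hwR : w ∈ R
      · exact Or.inl hwR
      · exact Or.inr (hE ⟨hw, hwR⟩)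
    · rintro _ (rfl | rfl)
      · exact hin hp
      · exact hin hq

/-! ### Behaviour of the zeros for large parameters -/

theorem norm_laplaceK_le {c γ : ℕ → ℝ} (hc0 : ∀ k, 0 ≤ c k) (hcs : Summable c) {d : ℝ}
    (hd : 0 < d) {z : ℂ} (hz : d ≤ z.im) : ‖laplaceK c γ z‖ ≤ (∑' k, c k) / d := by
  have h : ∀ k, ‖(c k : ℂ) / (z + (γ k : ℂ))‖ ≤ c k / d := fun k =>
    norm_div_le_of_dist (hc0 k) hd fun _ => by
      have := Complex.abs_im_le_norm (z + (γ k : ℂ))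
      simp only [Complex.add_im, Complex.ofReal_im, add_zero] at this
      exact hz.trans ((le_abs_self _).trans this)
  rw [← tsum_div_const]
  exact tsum_of_norm_bounded (hcs.div_const d).hasSum h

theorem notMem_poles_of_im_pos {γ : ℕ → ℝ} {z : ℂ} (hz : 0 < z.im) : z ∉ poles γ := by
  rw [notMem_poles_iff]
  intro k h
  have := congrArg Complex.im h
  simp at this
  linarith

/-- For large `a` there is a zero near `i a`. -/
theorem exists_mem_zeroSet_im_pos {c γ : ℕ → ℝ} (hc0 : ∀ k, 0 ≤ c k) (hcs : Summable c)
    (hγ_lim : Tendsto γ atTop atTop) {a β : ℝ} (ha : 0 < a) (haC : 8 * ∑' k, c k < a)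
    (hβ : 0 < β) (hβa : β ≤ a ^ 2) : ∃ z ∈ zeroSet c γ (a ^ 2) β, 0 < z.im := by
  set C := ∑' k, c k with hC
  have hC0 : 0 ≤ C := tsum_nonneg hc0
  set f : ℂ → ℂ := fun z => z ^ 2 + ((a ^ 2 : ℝ) : ℂ) - (β : ℂ) * laplaceK c γ z with hf
  set z₀ : ℂ := a * Complex.I with hz₀
  have hz₀im : z₀.im = a := by simp [hz₀]
  have hz₀norm : ‖z₀‖ = a := by simp [hz₀, ha.le]
  have him : ∀ z ∈ Metric.closedBall z₀ (a / 2), a / 2 ≤ z.im := by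
    intro z hz
    rw [Metric.mem_closedBall, dist_eq_norm] at hz
    have := (Complex.abs_im_le_norm (z - z₀)).trans hz
    rw [Complex.sub_im, hz₀im, abs_le] at this
    linarith [this.1]
  have hKb : ∀ z : ℂ, a / 2 ≤ z.im → ‖(β : ℂ) * laplaceK c γ z‖ ≤ 2 * C * a := by
    intro z hz
    rw [norm_mul, Complex.norm_of_nonneg hβ.le]
    calc β * ‖laplaceK c γ z‖ ≤ a ^ 2 * (C / (a / 2)) :=
          mul_le_mul hβa (norm_laplaceK_le hc0 hcs (half_pos ha) hz) (norm_nonneg _) (sq_nonneg a)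
      _ = 2 * C * a := by field_simp
  have hf₀ : ‖f z₀‖ ≤ C * a := by
    have : f z₀ = -((β : ℂ) * laplaceK c γ z₀) := by
      simp only [hf, hz₀, mul_pow, Complex.I_sq]
      push_cast
      ring
    rw [this, norm_neg, norm_mul, Complex.norm_of_nonneg hβ.le]
    calc β * ‖laplaceK c γ z₀‖ ≤ a ^ 2 * (C / a) :=
          mul_le_mul hβa (norm_laplaceK_le hc0 hcs ha hz₀im.ge) (norm_nonneg _) (sq_nonneg a)
      _ = C * a := by field_simp
  -- As `z₀² = -a²`, the polynomial part is `(z - z₀)(z + z₀)`, of modulus at least `(a/2)(3a/2)` on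
  -- the sphere; the `K̂` terms cost at most `C a + 2 C a`.
  have hsph : ∀ z ∈ Metric.sphere z₀ (a / 2), 3 / 4 * a ^ 2 - 3 * C * a ≤ ‖f z - f z₀‖ := by
    intro z hz
    have hz1 := hKb z (him z (Metric.sphere_subset_closedBall hz))
    rw [mem_sphere_iff_norm] at hz
    have e : (z - z₀) * (z + z₀) = (f z - f z₀) + (f z₀ + (β : ℂ) * laplaceK c γ z) := by
      have : z₀ ^ 2 = -((a ^ 2 : ℝ) : ℂ) := by
        rw [hz₀, mul_pow, Complex.I_sq]
        push_cast
        ring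
      simp only [hf]
      linear_combination -this
    have h1 : ‖(z - z₀) * (z + z₀)‖ ≤ ‖f z - f z₀‖ + (C * a + 2 * C * a) := by
      rw [e]
      refine (norm_add_le _ _).trans (add_le_add le_rfl ?_)
      exact (norm_add_le _ _).trans (add_le_add hf₀ hz1)
    have h2 : 3 / 2 * a ≤ ‖z + z₀‖ := by
      have h3 : ‖2 * z₀‖ ≤ ‖z + z₀‖ + ‖z - z₀‖ := by
        have e : 2 * z₀ = (z + z₀) - (z - z₀) := by ring
        rw [e]
        exact norm_sub_le _ _
      rw [norm_mul, hz₀norm, hz] at h3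
      norm_num at h3
      linarith
    rw [norm_mul, hz] at h1
    nlinarith
  -- The image contains the ball about `f z₀` of half the radius bounded in `hsph`, and `‖f z₀‖ ≤ C
  -- a`. The inequality needs `a > 20 C / 3`; the threshold `8 C` is enough.
  have hε : 2 * (C * a) < 3 / 4 * a ^ 2 - 3 * C * a := by nlinarith
  have hdiff : DifferentiableOn ℂ f (Metric.closedBall z₀ (a / 2)) := by
    intro z hz
    have hz' : z ∉ poles γ := notMem_poles_of_im_pos ((half_pos ha).trans_le (him z hz))
    have := differentiableAt_laplaceK hc0 hcs hγ_lim (fun k _ => notMem_poles_iff.1 hz' k)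
    have h : DifferentiableAt ℂ f z := by
      simp only [hf]
      fun_prop
    exact h.differentiableWithinAt
  have hdc : DiffContOnCl ℂ f (Metric.ball z₀ (a / 2)) := by
    refine DifferentiableOn.diffContOnCl ?_
    rwa [closure_ball z₀ (half_pos ha).ne']
  -- Otherwise `f` is constant on the upper half-plane by the identity theorem, against `hsph`.
  have hfreq : ∃ᶠ z in 𝓝 z₀, f z ≠ f z₀ := by
    have hU : IsOpen {z : ℂ | 0 < z.im} := isOpen_lt continuous_const Complex.continuous_im
    have hfU : DifferentiableOn ℂ f {z : ℂ | 0 < z.im} := by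
      intro z hz
      have := differentiableAt_laplaceK hc0 hcs hγ_lim
        (fun k _ => notMem_poles_iff.1 (notMem_poles_of_im_pos hz) k)
      have h : DifferentiableAt ℂ f z := by
        simp only [hf]
        fun_prop
      exact h.differentiableWithinAt
    intro hev
    have hev' : f =ᶠ[𝓝 z₀] fun _ => f z₀ := hev.mono fun z hz => not_not.1 hz
    have heq := (hfU.analyticOnNhd hU).eqOn_of_preconnected_of_eventuallyEq
      analyticOnNhd_const (convex_halfSpace_im_gt 0).isPreconnected
      (show 0 < z₀.im by rw [hz₀im]; exact ha) hev'
    have hz : z₀ + ((a / 2 : ℝ) : ℂ) ∈ Metric.sphere z₀ (a / 2) := by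
      rw [mem_sphere_iff_norm, add_sub_cancel_left, Complex.norm_of_nonneg (half_pos ha).le]
    have h1 := hsph _ hz
    have h2 : f (z₀ + ((a / 2 : ℝ) : ℂ)) = f z₀ := heq (show 0 < (z₀ + ((a / 2 : ℝ) : ℂ)).im by
      rw [Complex.add_im, Complex.ofReal_im, hz₀im]
      linarith)
    rw [h2, sub_self, norm_zero] at h1
    have := mul_nonneg hC0 ha.le
    linarith
  obtain ⟨z, hz, hfz⟩ := hdc.ball_subset_image_closedBall (half_pos ha) hsph hfreq
    (show (0 : ℂ) ∈ _ by
      rw [Metric.mem_ball, dist_zero_left]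
      linarith)
  have hzim := (half_pos ha).trans_le (him z hz)
  exact ⟨z, ⟨notMem_poles_of_im_pos hzim, hfz⟩, hzim⟩

/-- In the band the terms with `j < k` are negative, and those with `j > k` have denominators at
least `γ (k + 1) - γ k`. Only the term `j = k` can be large. -/
theorem tsum_div_le_of_mem_band {c γ : ℕ → ℝ} (hc : ∀ k, 0 < c k) (hcs : Summable c)
    (hγ_mono : StrictMono γ) (k : ℕ) : ∃ M, ∀ x ∈ band γ k,
    ∑' j, c j / (x + γ j) ≤ c k / (x + γ k) + M := by
  have hgap : 0 < γ (k + 1) - γ k := sub_pos.2 (hγ_mono k.lt_succ_self)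
  refine ⟨∑' j, c j / (γ (k + 1) - γ k), fun x hx => ?_⟩
  have h1 : HasSum (fun j => if j = k then c k / (x + γ k) else 0) (c k / (x + γ k)) :=
    hasSum_ite_eq k _
  have h2 := h1.add (hcs.div_const (γ (k + 1) - γ k)).hasSum
  have hpos : 0 < c k / (x + γ k) := div_pos (hc k) (band_add_pos hγ_mono hx le_rfl)
  have hgpos : ∀ j, 0 < c j / (γ (k + 1) - γ k) := fun j => div_pos (hc j) hgap
  have hle : ∀ j, c j / (x + γ j) ≤
      (if j = k then c k / (x + γ k) else 0) + c j / (γ (k + 1) - γ k) := by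
    intro j
    rcases lt_trichotomy j k with hj | rfl | hj
    · have := div_neg_of_pos_of_neg (hc j) (band_add_neg hx hj)
      rw [if_neg hj.ne, zero_add]
      exact this.le.trans (hgpos j).le
    · rw [if_pos rfl]
      linarith [hgpos j]
    · rw [if_neg hj.ne', zero_add]
      have := hγ_mono.monotone (Nat.succ_le_of_lt hj)
      exact div_le_div_of_nonneg_left (hc j).le hgap (by linarith [hx.1])
  by_cases hs : Summable fun j => c j / (x + γ j)
  · exact (hs.tsum_le_tsum hle h2.summable).trans h2.tsum_eq.le
  · rw [tsum_eq_zero_of_not_summable hs]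
    exact add_nonneg hpos.le (tsum_nonneg fun j => (hgpos j).le)

/-- Zeros in a band along which `(x² + α) / β → ∞` converge to its left endpoint. -/
theorem tendsto_left_of_mem_band {c γ : ℕ → ℝ} (hc : ∀ k, 0 < c k) (hcs : Summable c)
    (hγ_mono : StrictMono γ) {k : ℕ} {α β x : ℕ → ℝ} (hβ : ∀ n, 0 < β n)
    (hαβ : Tendsto (fun n => α n / β n) atTop atTop) (hx : ∀ n, x n ∈ band γ k)
    (hzero : ∀ n, realSymbol c γ (α n) (β n) (x n) = 0) :
    Tendsto x atTop (𝓝 (-γ k)) := by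
  obtain ⟨M, hM⟩ := tsum_div_le_of_mem_band hc hcs hγ_mono k
  have hlim : Tendsto (fun n => -γ k + c k / (α n / β n - M)) atTop (𝓝 (-γ k)) := by
    have h := (tendsto_const_nhds (x := c k)).div_atTop (tendsto_atTop_add_const_right _ (-M) hαβ)
    simpa [sub_eq_add_neg] using h.const_add (-γ k)
  refine tendsto_of_tendsto_of_tendsto_of_le_of_le' tendsto_const_nhds hlim
    (Eventually.of_forall fun n => (hx n).1.le) ?_
  filter_upwards [hαβ.eventually_gt_atTop M] with n hn
  have h1 := hM (x n) (hx n)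
  have h2 := hzero n
  have h3 := band_add_pos hγ_mono (hx n) le_rfl
  rw [realSymbol, sub_eq_zero] at h2
  -- At a zero `β K̂(x) = x² + α ≥ α`, so the singular term has to be large and `x + γ_k` small.
  have h4 : α n / β n ≤ ∑' j, c j / (x n + γ j) := by
    rw [div_le_iff₀ (hβ n)]
    nlinarith [sq_nonneg (x n)]
  have h5 : α n / β n - M ≤ c k / (x n + γ k) := by linarith
  have h6 : x n + γ k ≤ c k / (α n / β n - M) := by
    rw [le_div_iff₀ (sub_pos.2 hn)]
    rw [le_div_iff₀ h3] at h5
    linarith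
  linarith

/-! ### The operators in the eigenbasis -/

section Diagonal

variable {H : Type*} [NormedAddCommGroup H] [InnerProductSpace ℂ H]

theorem memℓp_of_norm_le {f g : ℕ → ℂ} (hg : Memℓp g 2) {C : ℝ} (h : ∀ n, ‖f n‖ ≤ C * ‖g n‖) :
    Memℓp f 2 := by
  have h1 : Memℓp (fun n => C * ‖g n‖) 2 := hg.norm.const_mul C
  exact h1.mono h

theorem exists_repr_eq (e : HilbertBasis ℕ ℂ H) {f : ℕ → ℂ} (hf : Memℓp f 2) :
    ∃ x : H, ∀ n, e.repr x n = f n := by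
  refine ⟨e.repr.symm (⟨f, hf⟩ : lp (fun _ : ℕ => ℂ) 2), fun n => ?_⟩
  rw [LinearIsometryEquiv.apply_symm_apply]

theorem ext_repr (e : HilbertBasis ℕ ℂ H) {x y : H} (h : ∀ n, e.repr x n = e.repr y n) : x = y :=
  e.repr.injective (lp.ext (funext h))

theorem norm_le_of_repr_le (e : HilbertBasis ℕ ℂ H) {x y : H} {C : ℝ} (hC : 0 ≤ C)
    (h : ∀ n, ‖e.repr x n‖ ≤ C * ‖e.repr y n‖) : ‖x‖ ≤ C * ‖y‖ := by
  have h1 : ‖e.repr x‖ ≤ ‖(C : ℂ) • e.repr y‖ := by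
    refine lp.norm_mono (by norm_num) fun n => ?_
    rw [lp.coeFn_smul, Pi.smul_apply, norm_smul, Complex.norm_of_nonneg hC]
    exact h n
  rwa [norm_smul, Complex.norm_of_nonneg hC, LinearIsometryEquiv.norm_map,
    LinearIsometryEquiv.norm_map] at h1

/-- The bounded diagonal operator with bounded entries `m n`. -/
theorem exists_diagonal (e : HilbertBasis ℕ ℂ H) {m : ℕ → ℂ} {C : ℝ} (hC : 0 ≤ C)
    (hm : ∀ n, ‖m n‖ ≤ C) :
    ∃ S : H →L[ℂ] H, ‖S‖ ≤ C ∧ ∀ y n, e.repr (S y) n = m n * e.repr y n := by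
  have hle : ∀ (y : H) n, ‖m n * e.repr y n‖ ≤ C * ‖e.repr y n‖ := fun y n => by
    rw [norm_mul]
    exact mul_le_mul_of_nonneg_right (hm n) (norm_nonneg _)
  choose s hs using fun y => exists_repr_eq e (memℓp_of_norm_le (lp.memℓp (e.repr y)) (hle y))
  let T : H →ₗ[ℂ] H :=
    { toFun := s
      map_add' := fun x y => ext_repr e fun n => by
        simp only [map_add, lp.coeFn_add, Pi.add_apply, hs, mul_add]
      map_smul' := fun a x => ext_repr e fun n => by
        simp only [map_smul, lp.coeFn_smul, Pi.smul_apply, hs, smul_eq_mul, RingHom.id_apply]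
        ring }
  have hT : ∀ y, ‖T y‖ ≤ C * ‖y‖ := fun y =>
    norm_le_of_repr_le e hC fun n => (congrArg norm (hs y n)).trans_le (hle y n)
  exact ⟨T.mkContinuous C hT, T.mkContinuous_norm_le hC hT, hs⟩

theorem repr_basis (e : HilbertBasis ℕ ℂ H) (m n : ℕ) :
    e.repr (e m) n = if n = m then 1 else 0 := by
  rw [e.repr_self, lp.single_apply]
  split_ifs with h
  · subst h; simp
  · simp [h]

variable {A : H →ₗ.[ℂ] H} {e : HilbertBasis ℕ ℂ H} {a : ℕ → ℝ}

theorem mem_opSq_domain_iff {x : H} :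
    x ∈ (opSq A).domain ↔ ∃ h : x ∈ A.domain, A ⟨x, h⟩ ∈ A.domain := by
  constructor
  · rintro ⟨⟨y, hy, rfl⟩, -⟩
    exact ⟨y.2, hy⟩
  · rintro ⟨h, h'⟩
    exact ⟨⟨⟨x, h⟩, h', rfl⟩, h⟩

theorem opSq_apply (x : (opSq A).domain) (h : (x : H) ∈ A.domain)
    (h' : A ⟨(x : H), h⟩ ∈ A.domain) : opSq A x = A ⟨A ⟨(x : H), h⟩, h'⟩ := rfl

theorem repr_opPow (s : ℝ) (x : (opPow e a s).domain) (n : ℕ) :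
    e.repr (opPow e a s x) n = ((a n ^ s : ℝ) : ℂ) * e.repr (x : H) n := by
  change e.repr (e.repr.symm _) n = _
  rw [LinearIsometryEquiv.apply_symm_apply]

theorem symbolL_domain (A : H →ₗ.[ℂ] H) (e : HilbertBasis ℕ ℂ H) (a c γ : ℕ → ℝ) (θ : ℝ) (z : ℂ) :
    (symbolL A e a c γ θ z).domain = (⊤ ⊓ (opSq A).domain) ⊓ (opPow e a (2 * θ)).domain := rfl

theorem ell_eq {c γ : ℕ → ℝ} {θ : ℝ} {n : ℕ} (ha : 0 < a n) (z : ℂ) :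
    ell a c γ θ n z =
      z ^ 2 + ((a n ^ 2 : ℝ) : ℂ) - ((a n ^ (2 * θ) : ℝ) : ℂ) * laplaceK c γ z := by
  have h : a n ^ (2 * θ) * a n ^ (2 * (1 - θ)) = a n ^ 2 := by
    rw [← Real.rpow_add ha, ← Real.rpow_natCast]
    congr 1
    push_cast
    ring
  have h' : ((a n ^ (2 * θ) : ℝ) : ℂ) * ((a n ^ (2 * (1 - θ)) : ℝ) : ℂ) = (a n : ℂ) ^ 2 := by
    rw [← Complex.ofReal_mul, h, Complex.ofReal_pow]
  have h0 : ((a n ^ (2 * (1 - θ)) : ℝ) : ℂ) ≠ 0 :=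
    Complex.ofReal_ne_zero.2 (Real.rpow_pos_of_pos ha _).ne'
  rw [ell, Complex.ofReal_pow, ← h']
  field_simp
  ring

theorem rpow_two_mul_le (ha : ∀ n, 1 ≤ a n) {θ : ℝ} (hθ : θ ≤ 1) (n : ℕ) :
    a n ^ (2 * θ) ≤ a n ^ 2 := by
  rw [← Real.rpow_natCast (a n) 2]
  refine Real.rpow_le_rpow_of_exponent_le (ha n) ?_
  push_cast
  linarith

variable [CompleteSpace H]

theorem isFormalAdjoint_self (hA : IsSelfAdjoint A) : A.IsFormalAdjoint A := by
  have h := LinearPMap.adjoint_isFormalAdjoint hA.dense_domain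
  rwa [LinearPMap.isSelfAdjoint_def.1 hA] at h

/-- A self-adjoint operator with eigenbasis `e` acts diagonally on its domain. -/
theorem repr_apply (hA : IsSelfAdjoint A) (he : ∀ n, ∃ h : e n ∈ A.domain,
    A ⟨e n, h⟩ = (a n : ℂ) • e n) (x : A.domain) (n : ℕ) :
    e.repr (A x) n = (a n : ℂ) * e.repr (x : H) n := by
  obtain ⟨h, hen⟩ := he n
  have h1 := isFormalAdjoint_self hA ⟨e n, h⟩ x
  rw [hen, inner_smul_left, Complex.conj_ofReal] at h1
  rw [e.repr_apply_apply, e.repr_apply_apply, ← h1]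

/-- Surjectivity of `A` yields membership in the domain: `S y` is in it, and its coefficients are
those of `x` because `A (S y) = y`. -/
theorem mem_domain_of_repr_eq (hA : IsPositiveWithCompactInverse A)
    (he : ∀ n, ∃ h : e n ∈ A.domain, A ⟨e n, h⟩ = (a n : ℂ) • e n) (ha : ∀ n, a n ≠ 0)
    {x y : H} (hxy : ∀ n, e.repr y n = (a n : ℂ) * e.repr x n) :
    ∃ h : x ∈ A.domain, A ⟨x, h⟩ = y := by
  obtain ⟨S, hS, -⟩ := hA.compact_inverse
  obtain ⟨h, hSy⟩ := hS.1 y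
  have : S y = x := by
    refine ext_repr e fun n => ?_
    have h1 := repr_apply hA.selfAdjoint he ⟨S y, h⟩ n
    rw [hSy, hxy] at h1
    exact (mul_left_cancel₀ (Complex.ofReal_ne_zero.2 (ha n)) h1).symm
  subst this
  exact ⟨h, hSy⟩

theorem repr_opSq (hA : IsSelfAdjoint A) (he : ∀ n, ∃ h : e n ∈ A.domain,
    A ⟨e n, h⟩ = (a n : ℂ) • e n) (x : (opSq A).domain) (n : ℕ) :
    e.repr (opSq A x) n = (a n : ℂ) ^ 2 * e.repr (x : H) n := by
  obtain ⟨h, h'⟩ := mem_opSq_domain_iff.1 x.2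
  rw [opSq_apply x h h', repr_apply hA he, repr_apply hA he]
  ring

theorem repr_symbolL {c γ : ℕ → ℝ} {θ : ℝ} (hA : IsSelfAdjoint A)
    (he : ∀ n, ∃ h : e n ∈ A.domain, A ⟨e n, h⟩ = (a n : ℂ) • e n) (ha : ∀ n, 0 < a n) (z : ℂ)
    (x : (symbolL A e a c γ θ z).domain) (n : ℕ) :
    e.repr (symbolL A e a c γ θ z x) n = ell a c γ θ n z * e.repr (x : H) n := by
  have h1 : symbolL A e a c γ θ z x = z ^ 2 • (x : H) + opSq A ⟨x, x.2.1.2⟩ -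
      laplaceK c γ z • opPow e a (2 * θ) ⟨x, x.2.2⟩ := rfl
  rw [h1, map_sub, map_add, map_smul, map_smul]
  simp only [lp.coeFn_sub, lp.coeFn_add, lp.coeFn_smul, Pi.sub_apply, Pi.add_apply, Pi.smul_apply,
    smul_eq_mul]
  rw [repr_opSq hA he, repr_opPow, ell_eq (ha n)]
  push_cast
  ring

/-- The domain of `L(z)` contains the vectors with square summable `a_n² x_n`. -/
theorem mem_symbolL_domain {c γ : ℕ → ℝ} {θ : ℝ} (hA : IsPositiveWithCompactInverse A)
    (he : ∀ n, ∃ h : e n ∈ A.domain, A ⟨e n, h⟩ = (a n : ℂ) • e n) (ha : ∀ n, 1 ≤ a n)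
    (hθ : θ ≤ 1) (z : ℂ) {x : H} (hx : Memℓp (fun n => (a n : ℂ) ^ 2 * e.repr x n) 2) :
    x ∈ (symbolL A e a c γ θ z).domain := by
  have ha0 : ∀ n, a n ≠ 0 := fun n => (one_pos.trans_le (ha n)).ne'
  have hn : ∀ n, ‖(a n : ℂ)‖ = a n := fun n =>
    Complex.norm_of_nonneg (zero_le_one.trans (ha n))
  obtain ⟨w, hw⟩ := exists_repr_eq e hx
  obtain ⟨y, hy⟩ := exists_repr_eq e (f := fun n => (a n : ℂ) * e.repr x n)
    (memℓp_of_norm_le (C := 1) hx fun n => by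
      rw [norm_mul, norm_mul, norm_pow, one_mul, hn]
      exact mul_le_mul_of_nonneg_right (le_self_pow₀ (ha n) two_ne_zero) (norm_nonneg _))
  obtain ⟨h1, e1⟩ := mem_domain_of_repr_eq hA he ha0 hy
  obtain ⟨h2, -⟩ := mem_domain_of_repr_eq (x := y) (y := w) hA he ha0 fun n => by
    rw [hw, hy]
    ring
  rw [symbolL_domain]
  refine ⟨⟨trivial, mem_opSq_domain_iff.2 ⟨h1, by rwa [e1]⟩⟩, ?_⟩
  refine memℓp_of_norm_le (C := 1) hx fun n => ?_
  rw [norm_mul, norm_mul, norm_pow, one_mul, hn,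
    Complex.norm_of_nonneg (Real.rpow_nonneg (zero_le_one.trans (ha n)) _)]
  exact mul_le_mul_of_nonneg_right (rpow_two_mul_le ha hθ n) (norm_nonneg _)

/-- The inverse is the diagonal operator with entries `1 / ℓ_n`. The factor `a_n²` in the lower
bound makes its range lie in the domain of `A²`; boundedness alone would need less. -/
theorem exists_isBoundedInverse {c γ : ℕ → ℝ} {θ : ℝ} (hA : IsPositiveWithCompactInverse A)
    (he : ∀ n, ∃ h : e n ∈ A.domain, A ⟨e n, h⟩ = (a n : ℂ) • e n) (ha : ∀ n, 1 ≤ a n)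
    (hθ : θ ≤ 1) {z : ℂ} {δ : ℝ} (hδ : 0 < δ) (h : ∀ n, δ * a n ^ 2 ≤ ‖ell a c γ θ n z‖) :
    ∃ S, IsBoundedInverse (symbolL A e a c γ θ z) S ∧ ‖S‖ ≤ 1 / δ := by
  have ha0 : ∀ n, 0 < a n := fun n => one_pos.trans_le (ha n)
  have hpos : ∀ n, 0 < δ * a n ^ 2 := fun n => mul_pos hδ (pow_pos (ha0 n) 2)
  have hne : ∀ n, ell a c γ θ n z ≠ 0 := fun n => norm_pos_iff.1 ((hpos n).trans_le (h n))
  have hbd : ∀ n, ‖(ell a c γ θ n z)⁻¹‖ * a n ^ 2 ≤ 1 / δ := by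
    intro n
    rw [norm_inv, ← div_eq_inv_mul, div_le_div_iff₀ (norm_pos_iff.2 (hne n)) hδ]
    linarith [h n]
  obtain ⟨S, hS, hSr⟩ := exists_diagonal e (m := fun n => (ell a c γ θ n z)⁻¹)
    (one_div_pos.2 hδ).le (fun n => by
      refine le_trans ?_ (hbd n)
      exact le_mul_of_one_le_right (norm_nonneg _) (one_le_pow₀ (ha n)))
  refine ⟨S, ⟨fun y => ?_, fun x => ?_⟩, hS⟩
  · have hmem : S y ∈ (symbolL A e a c γ θ z).domain := by
      refine mem_symbolL_domain hA he ha hθ z (memℓp_of_norm_le (lp.memℓp (e.repr y))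
        (C := 1 / δ) fun n => ?_)
      rw [hSr, ← mul_assoc, norm_mul, norm_mul, norm_pow, Complex.norm_of_nonneg (ha0 n).le,
        mul_comm (a n ^ 2)]
      exact mul_le_mul_of_nonneg_right (hbd n) (norm_nonneg _)
    refine ⟨hmem, ext_repr e fun n => ?_⟩
    rw [repr_symbolL hA.selfAdjoint he ha0, hSr, mul_inv_cancel_left₀ (hne n)]
  · refine ext_repr e fun n => ?_
    rw [hSr, repr_symbolL hA.selfAdjoint he ha0, inv_mul_cancel_left₀ (hne n)]

/-- If `ℓ_n(z) = 0`, then `e n` is in the kernel of `L(z)`. -/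
theorem ell_ne_zero_of_isBoundedInverse {c γ : ℕ → ℝ} {θ : ℝ}
    (hA : IsPositiveWithCompactInverse A)
    (he : ∀ n, ∃ h : e n ∈ A.domain, A ⟨e n, h⟩ = (a n : ℂ) • e n) (ha : ∀ n, 1 ≤ a n)
    (hθ : θ ≤ 1) {z : ℂ} {S : H →L[ℂ] H} (hS : IsBoundedInverse (symbolL A e a c γ θ z) S)
    (n : ℕ) : ell a c γ θ n z ≠ 0 := by
  intro h0
  have hmem : e n ∈ (symbolL A e a c γ θ z).domain := by
    refine mem_symbolL_domain hA he ha hθ z (memℓp_of_norm_le (lp.memℓp (e.repr (e n)))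
      (C := a n ^ 2) fun m => ?_)
    rw [repr_basis]
    split_ifs with h
    · subst h
      simp
    · simp
  have h1 : symbolL A e a c γ θ z ⟨e n, hmem⟩ = 0 := by
    refine ext_repr e fun m => ?_
    rw [repr_symbolL hA.selfAdjoint he (fun n => one_pos.trans_le (ha n)), repr_basis]
    split_ifs with h
    · subst h
      simp [h0]
    · simp
  have h2 := hS.2 ⟨e n, hmem⟩
  rw [h1, map_zero] at h2
  have h3 := e.orthonormal.ne_zero n
  exact h3 h2.symm

/-- A self-adjoint operator with unbounded eigenvalues is not everywhere defined. -/
theorem domain_ne_top (hA : IsSelfAdjoint A)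
    (he : ∀ n, ∃ h : e n ∈ A.domain, A ⟨e n, h⟩ = (a n : ℂ) • e n)
    (ha_lim : Tendsto a atTop atTop) : ∃ x, x ∉ A.domain := by
  by_contra hcon
  push Not at hcon
  let T : H →ₗ[ℂ] H := A.toFun.comp (LinearMap.id.codRestrict A.domain hcon)
  have hsymm : T.IsSymmetric := by
    intro x y
    exact isFormalAdjoint_self hA ⟨x, hcon x⟩ ⟨y, hcon y⟩
  -- Hellinger–Toeplitz: an everywhere defined symmetric operator is bounded, hence so are its
  -- eigenvalues.
  let T' : H →L[ℂ] H := ⟨T, hsymm.continuous⟩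
  obtain ⟨n, hn⟩ := (ha_lim.eventually_gt_atTop ‖T'‖).exists
  obtain ⟨h, hen⟩ := he n
  have h1 : T' (e n) = (a n : ℂ) • e n := hen
  have h2 := T'.le_opNorm (e n)
  rw [h1, norm_smul, e.orthonormal.1 n, Complex.norm_real, mul_one, mul_one] at h2
  exact absurd (hn.trans_le (le_abs_self _)) (not_lt.2 h2)

/-- If `θ = 1` and `K̂(z) = 1`, then `L(z)` has no bounded inverse. -/
theorem laplaceK_ne_one_of_isBoundedInverse {c γ : ℕ → ℝ} (hA : IsPositiveWithCompactInverse A)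
    (he : ∀ n, ∃ h : e n ∈ A.domain, A ⟨e n, h⟩ = (a n : ℂ) • e n) (ha : ∀ n, 1 ≤ a n)
    (ha_lim : Tendsto a atTop atTop) {z : ℂ} {S : H →L[ℂ] H}
    (hS : IsBoundedInverse (symbolL A e a c γ 1 z) S) : laplaceK c γ z ≠ 1 := by
  intro hK
  have ha0 : ∀ n, 0 < a n := fun n => one_pos.trans_le (ha n)
  obtain ⟨y, hy⟩ := domain_ne_top hA.selfAdjoint he ha_lim
  obtain ⟨h, hSy⟩ := hS.1 y
  -- Here `L(z)` reduces to `z² I` on the domain of `A²`, so its range stays inside the domain of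
  -- `A`, which omits `y`.
  have hyS : y = z ^ 2 • S y := by
    refine ext_repr e fun n => ?_
    conv_lhs => rw [← hSy]
    rw [repr_symbolL hA.selfAdjoint he ha0, map_smul, lp.coeFn_smul, Pi.smul_apply, smul_eq_mul,
      ell_eq (ha0 n), hK, mul_one, mul_one, Real.rpow_two]
    simp
  obtain ⟨hSA, -⟩ := mem_opSq_domain_iff.1 h.1.2
  exact hy (hyS ▸ A.domain.smul_mem _ hSA)

end Diagonal

/-! ### The spectrum -/

section Spectrum

theorem zerosEll_eq {a : ℕ → ℝ} (ha : ∀ n, 1 ≤ a n) (c γ : ℕ → ℝ) (θ : ℝ) (n : ℕ) :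
    zerosEll a c γ θ n = zeroSet c γ (a n ^ 2) (a n ^ (2 * θ)) := by
  ext z
  simp only [zerosEll, zeroSet, Set.mem_ofPred_eq, ell_eq (one_pos.trans_le (ha n))]

theorem tendsto_sq_div_rpow {a : ℕ → ℝ} (ha : ∀ n, 1 ≤ a n) (ha_lim : Tendsto a atTop atTop)
    {θ : ℝ} (hθ : θ < 1) : Tendsto (fun n => a n ^ 2 / a n ^ (2 * θ)) atTop atTop := by
  have h := (tendsto_rpow_atTop (by linarith : 0 < 2 - 2 * θ)).comp ha_lim
  refine h.congr fun n => ?_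
  rw [Function.comp_apply, Real.rpow_sub (one_pos.trans_le (ha n)), Real.rpow_two]

theorem exists_tendsto_rpow_div_sq {a : ℕ → ℝ} (ha : ∀ n, 1 ≤ a n)
    (ha_lim : Tendsto a atTop atTop) {θ : ℝ} (hθ : θ ≤ 1) :
    ∃ q : ℝ, Tendsto (fun n => a n ^ (2 * θ) / a n ^ 2) atTop (𝓝 q) ∧
      (θ < 1 ∧ q = 0 ∨ θ = 1 ∧ q = 1) := by
  rcases lt_or_eq_of_le hθ with h | rfl
  · refine ⟨0, ?_, Or.inl ⟨h, rfl⟩⟩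
    refine (tendsto_sq_div_rpow ha ha_lim h).inv_tendsto_atTop.congr fun n => ?_
    rw [Pi.inv_apply, inv_div]
  · refine ⟨1, tendsto_const_nhds.congr fun n => ?_, Or.inr ⟨rfl, rfl⟩⟩
    rw [mul_one, Real.rpow_two, div_self (pow_pos (one_pos.trans_le (ha n)) 2).ne']

/-- The quotients `ℓ_n / a_n²` converge to `1 - q K̂(z)`, with `q = 0` for `θ < 1` and `q = 1` for
`θ = 1`. A sequence of nonzero terms with nonzero limit is bounded away from zero. -/
theorem exists_mul_sq_le_norm_ell {a c γ : ℕ → ℝ} {θ : ℝ} (ha : ∀ n, 1 ≤ a n)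
    (ha_lim : Tendsto a atTop atTop) (hθ : θ ≤ 1) {z : ℂ} (hell : ∀ n, ell a c γ θ n z ≠ 0)
    (hK : θ = 1 → laplaceK c γ z ≠ 1) : ∃ δ > 0, ∀ n, δ * a n ^ 2 ≤ ‖ell a c γ θ n z‖ := by
  obtain ⟨q, hq, hcase⟩ := exists_tendsto_rpow_div_sq ha ha_lim hθ
  have ha2 : ∀ n, 0 < a n ^ 2 := fun n => pow_pos (one_pos.trans_le (ha n)) 2
  have hg : (1 : ℂ) - (q : ℂ) * laplaceK c γ z ≠ 0 := by
    rcases hcase with ⟨-, rfl⟩ | ⟨h1, rfl⟩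
    · simp
    · intro h
      apply hK h1
      rw [Complex.ofReal_one, one_mul, sub_eq_zero] at h
      exact h.symm
  have hlim : Tendsto (fun n => ell a c γ θ n z / ((a n ^ 2 : ℝ) : ℂ)) atTop
      (𝓝 ((1 : ℂ) - (q : ℂ) * laplaceK c γ z)) := by
    have h1 : Tendsto (fun n => (((a n ^ 2)⁻¹ : ℝ) : ℂ)) atTop (𝓝 ((0 : ℝ) : ℂ)) :=
      (Complex.continuous_ofReal.tendsto 0).comp
        (((tendsto_pow_atTop two_ne_zero).comp ha_lim).inv_tendsto_atTop)
    have h2 : Tendsto (fun n => ((a n ^ (2 * θ) / a n ^ 2 : ℝ) : ℂ)) atTop (𝓝 (q : ℂ)) :=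
      (Complex.continuous_ofReal.tendsto q).comp hq
    have h3 := ((h1.const_mul (z ^ 2)).add_const (1 : ℂ)).sub (h2.mul_const (laplaceK c γ z))
    rw [Complex.ofReal_zero, mul_zero, zero_add] at h3
    refine h3.congr fun n => ?_
    have h0 : (a n : ℂ) ≠ 0 := Complex.ofReal_ne_zero.2 (one_pos.trans_le (ha n)).ne'
    rw [ell_eq (one_pos.trans_le (ha n))]
    push_cast
    field_simp
  have hev := hlim.norm.eventually_const_le (half_lt_self (norm_pos_iff.2 hg))
  obtain ⟨δ, hδ, h⟩ := exists_pos_le_of_eventually (half_pos (norm_pos_iff.2 hg)) hev fun n =>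
    norm_pos_iff.2 (div_ne_zero (hell n) (Complex.ofReal_ne_zero.2 (ha2 n).ne'))
  refine ⟨δ, hδ, fun n => ?_⟩
  have := h n
  rwa [norm_div, Complex.norm_of_nonneg (ha2 n).le, le_div_iff₀ (ha2 n)] at this

/-- The set of zeros of all `ℓ_n` accumulates at a point only if `ℓ_n / a_n²` is not bounded away
from zero there. -/
theorem eventually_ell_ne_zero {a c γ : ℕ → ℝ} {θ : ℝ} (ha : ∀ n, 1 ≤ a n) (hθ : θ ≤ 1)
    (hc0 : ∀ k, 0 ≤ c k) (hcs : Summable c) (hγ_lim : Tendsto γ atTop atTop) {z : ℂ}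
    (hz : z ∉ poles γ) {δ : ℝ} (hδ : 0 < δ) (h : ∀ n, δ * a n ^ 2 ≤ ‖ell a c γ θ n z‖) :
    ∀ᶠ w in 𝓝 z, ∀ n, ell a c γ θ n w ≠ 0 := by
  have hK := (differentiableAt_laplaceK hc0 hcs hγ_lim
    (fun k _ => notMem_poles_iff.1 hz k)).continuousAt
  have hcont : ContinuousAt
      (fun w => ‖z ^ 2 - w ^ 2‖ + ‖laplaceK c γ z - laplaceK c γ w‖) z := by
    fun_prop
  have hlt : ‖z ^ 2 - z ^ 2‖ + ‖laplaceK c γ z - laplaceK c γ z‖ < δ := by simpa using hδ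
  filter_upwards [hcont.tendsto.eventually_lt_const hlt] with w hw n h0
  have ha0 := one_pos.trans_le (ha n)
  -- If `ℓ_n(w) = 0`, then `ℓ_n(z) = ℓ_n(z) - ℓ_n(w)`, which is smaller than `δ a_n²` for `w` close
  -- to `z`, uniformly in `n`.
  have e : ell a c γ θ n z = (z ^ 2 - w ^ 2) -
      ((a n ^ (2 * θ) : ℝ) : ℂ) * (laplaceK c γ z - laplaceK c γ w) := by
    rw [ell_eq ha0] at h0 ⊢
    linear_combination h0
  have h1 := h n
  rw [e] at h1
  have h2 := h1.trans (norm_sub_le _ _)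
  rw [norm_mul, Complex.norm_of_nonneg (Real.rpow_nonneg ha0.le _)] at h2
  have h3 := mul_le_mul_of_nonneg_right (rpow_two_mul_le ha hθ n)
    (norm_nonneg (laplaceK c γ z - laplaceK c γ w))
  have h4 : 1 * ‖z ^ 2 - w ^ 2‖ ≤ a n ^ 2 * ‖z ^ 2 - w ^ 2‖ :=
    mul_le_mul_of_nonneg_right (one_le_pow₀ (ha n)) (norm_nonneg _)
  have h5 := mul_lt_mul_of_pos_left hw (pow_pos ha0 2)
  linarith

/-- The solutions of `K̂(z) = 1` are limits of zeros of `ℓ_n` if `θ = 1`. -/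
theorem mem_closure_of_laplaceK_eq_one {a c γ : ℕ → ℝ} (ha : ∀ n, 1 ≤ a n)
    (ha_lim : Tendsto a atTop atTop) (hc : ∀ k, 0 < c k) (hcs : Summable c)
    (hγ_pos : ∀ k, 0 < γ k) (hγ_lim : Tendsto γ atTop atTop)
    (hs : Summable fun k => c k / γ k) (h1 : ∑' k, c k / γ k < 1) {z : ℂ} (hz : z ∉ poles γ)
    (hK : laplaceK c γ z = 1) : z ∈ closure (⋃ n, zerosEll a c γ 1 n) := by
  have hc0 : ∀ k, 0 ≤ c k := fun k => (hc k).le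
  -- `K̂(z) - K̂(z̄)` is a positive multiple of `z̄ - z`, so a real value is taken only at real
  -- points.
  obtain ⟨x, rfl⟩ : ∃ x : ℝ, z = x := by
    obtain ⟨s, hs, e⟩ := laplaceK_sub_of_positivePair hc hcs hγ_lim hz (conj_notMem_poles hz)
      (positivePair_conj hz)
    rw [laplaceK_conj, hK, map_one, sub_self] at e
    have hs' : (s : ℂ) ≠ 0 := Complex.ofReal_ne_zero.2 hs.ne'
    have e' := sub_eq_zero.1 ((mul_eq_zero.1 e.symm).resolve_right hs')
    exact ⟨z.re, (Complex.conj_eq_iff_re.1 e').symm⟩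
  have hKx : ∑' k, c k / (x + γ k) = 1 := by
    rw [laplaceK_ofReal] at hK
    exact_mod_cast hK
  have hx0 : x < 0 := by
    by_contra hx
    exact (tsum_div_lt_one hc hγ_pos hs h1 (not_lt.1 hx)).ne hKx
  have hpole := eventually_notMem_poles (P := fun _ => True) hγ_lim
    (fun k _ => notMem_poles_iff.1 hz k)
  obtain ⟨ρ, hρ, hball⟩ := Metric.eventually_nhds_iff.1 hpole
  rw [Metric.mem_closure_iff]
  intro ε hε
  set η := min ε ρ / 2 with hη
  have hη0 : 0 < η := half_pos (lt_min hε hρ)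
  have hηε : η < ε := (half_lt_self (lt_min hε hρ)).trans_le (min_le_left _ _)
  have hηρ : η < ρ := (half_lt_self (lt_min hε hρ)).trans_le (min_le_right _ _)
  have hdist : ∀ t ∈ Set.Icc (x - η) x, dist (t : ℂ) (x : ℂ) ≤ η := by
    intro t ht
    rw [dist_eq_norm, ← Complex.ofReal_sub, Complex.norm_real, Real.norm_eq_abs, abs_le]
    constructor <;> linarith [ht.1, ht.2]
  have hnp : ∀ t ∈ Set.Icc (x - η) x, (t : ℂ) ∉ poles γ := fun t ht =>
    notMem_poles_iff.2 fun k => hball ((hdist t ht).trans_lt hηρ) k trivial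
  have hyx : x - η ≤ x := by linarith
  -- A sign change of some `t + γ k` on `[x - η, x]` would place a pole in this pole-free interval.
  have hpair : PositivePair γ ((x - η : ℝ) : ℂ) (x : ℂ) := by
    refine positivePair_ofReal fun k => ?_
    by_contra hcon
    have hle : x - η + γ k ≤ 0 ∧ 0 ≤ x + γ k := by
      constructor <;> by_contra h <;> apply hcon
      · exact mul_pos (by linarith) (by linarith)
      · exact mul_pos_of_neg_of_neg (by linarith) (by linarith)
    refine ofReal_notMem_poles_iff.1 (hnp (-γ k) ⟨by linarith, by linarith⟩) k ?_
    ring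
  obtain ⟨s, hspos, e⟩ := laplaceK_sub_of_positivePair hc hcs hγ_lim
    (hnp _ (Set.left_mem_Icc.2 hyx)) hz hpair
  have hKy : ∑' k, c k / (x - η + γ k) - 1 = η * s := by
    rw [hK, laplaceK_ofReal] at e
    have : (x : ℂ) - ((x - η : ℝ) : ℂ) = (η : ℂ) := by
      push_cast
      ring
    rw [this] at e
    exact_mod_cast e
  have hlim : Tendsto (fun n => η * s * a n ^ 2) atTop atTop :=
    ((tendsto_pow_atTop two_ne_zero).comp ha_lim).const_mul_atTop (mul_pos hη0 hspos)
  obtain ⟨n, hn⟩ := (hlim.eventually_gt_atTop ((x - η) ^ 2)).exists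
  -- `K̂` decreases between poles, so `K̂(x - η) = 1 + η s` and the value is `(x - η)² - a_n² η s`,
  -- negative for large `n`. At `x` the value is `x² > 0`, which gives a zero in between.
  have hfy : realSymbol c γ (a n ^ 2) (a n ^ 2) (x - η) < 0 := by
    have : ∑' k, c k / (x - η + γ k) = 1 + η * s := by linarith
    rw [realSymbol, this]
    linarith
  have hfx : 0 < realSymbol c γ (a n ^ 2) (a n ^ 2) x := by
    rw [realSymbol, hKx]
    have := pow_pos (neg_pos.2 hx0) 2
    linarith
  have hcont : ContinuousOn (realSymbol c γ (a n ^ 2) (a n ^ 2)) (Set.Icc (x - η) x) :=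
    fun t ht => (continuousAt_realSymbol hc0 hcs hγ_lim _ _ (hnp t ht)).continuousWithinAt
  obtain ⟨t, ht, hft⟩ := intermediate_value_Icc hyx hcont ⟨hfy.le, hfx.le⟩
  refine ⟨(t : ℂ), Set.mem_iUnion.2 ⟨n, ?_⟩, ?_⟩
  · rw [zerosEll_eq ha, mul_one, Real.rpow_two, ofReal_mem_zeroSet_iff]
    exact ⟨hnp t ht, hft⟩
  · rw [dist_comm]
    exact (hdist t ht).trans_lt hηε

theorem tendsto_norm_laplaceK_atTop {c γ : ℕ → ℝ} (hc : ∀ k, 0 < c k) (hcs : Summable c)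
    (hγ_mono : StrictMono γ) (hγ_lim : Tendsto γ atTop atTop) (k : ℕ) :
    Tendsto (fun z => ‖laplaceK c γ z‖) (𝓝[≠] (-(γ k) : ℂ)) atTop := by
  have h1 := (tendsto_mul_laplaceK (fun k => (hc k).le) hcs hγ_mono hγ_lim k).norm
  rw [Complex.norm_of_nonneg (hc k).le] at h1
  have h2 : Tendsto (fun z : ℂ => ‖z + (γ k : ℂ)‖⁻¹) (𝓝[≠] (-(γ k) : ℂ)) atTop := by
    have := tendsto_norm_sub_self_nhdsNE (-(γ k) : ℂ)
    simp only [sub_neg_eq_add] at this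
    exact this.inv_tendsto_nhdsGT_zero
  refine (h1.pos_mul_atTop (hc k) h2).congr' ?_
  filter_upwards [self_mem_nhdsWithin] with z hz
  have hzk : ‖z + (γ k : ℂ)‖ ≠ 0 := norm_ne_zero_iff.2 fun h => hz (by
    rw [Set.mem_singleton_iff]
    linear_combination h)
  rw [norm_mul]
  field_simp

variable {H : Type*} [NormedAddCommGroup H] [InnerProductSpace ℂ H] [CompleteSpace H]
  {A : H →ₗ.[ℂ] H} {e : HilbertBasis ℕ ℂ H} {a c γ : ℕ → ℝ} {θ : ℝ}

/-- The poles of `K̂` belong to the resolvent set if `θ = 1`. -/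
theorem poles_subset_resolventSetL (hA : IsPositiveWithCompactInverse A)
    (he : ∀ n, ∃ h : e n ∈ A.domain, A ⟨e n, h⟩ = (a n : ℂ) • e n) (ha : ∀ n, 1 ≤ a n)
    (hc : ∀ k, 0 < c k) (hcs : Summable c) (hγ_mono : StrictMono γ)
    (hγ_lim : Tendsto γ atTop atTop) : poles γ ⊆ resolventSetL A e a c γ 1 := by
  rintro _ ⟨k, rfl⟩
  refine Or.inr ⟨⟨k, rfl⟩, 1 / 1, ?_⟩
  have hnear : ∀ᶠ w in 𝓝[≠] (-(γ k) : ℂ), ‖w‖ ^ 2 < ‖(-(γ k) : ℂ)‖ ^ 2 + 1 := by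
    have : Continuous fun w : ℂ => ‖w‖ ^ 2 := by fun_prop
    exact ((this.tendsto _).eventually_lt_const (lt_add_one _)).filter_mono nhdsWithin_le_nhds
  -- Since `‖ℓ_n(w)‖ ≥ a_n² (‖K̂(w)‖ - 1) - ‖w‖²` and `‖w‖² ≤ (γ_k² + 1) a_n²`, the bound `‖K̂(w)‖ ≥
  -- γ_k² + 3` leaves at least `a_n²`.
  filter_upwards [hnear, (tendsto_norm_laplaceK_atTop hc hcs hγ_mono hγ_lim k).eventually_ge_atTop
    (‖(-(γ k) : ℂ)‖ ^ 2 + 1 + 2)] with w hw hKw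
  refine exists_isBoundedInverse hA he ha le_rfl one_pos fun n => ?_
  have ha1 := one_le_pow₀ (n := 2) (ha n)
  have ha2 : ‖((a n ^ 2 : ℝ) : ℂ)‖ = a n ^ 2 := Complex.norm_of_nonneg (sq_nonneg _)
  rw [ell_eq (one_pos.trans_le (ha n)), mul_one, Real.rpow_two, one_mul]
  have h1 := norm_sub_norm_le (((a n ^ 2 : ℝ) : ℂ) * laplaceK c γ w)
    (w ^ 2 + ((a n ^ 2 : ℝ) : ℂ))
  have h2 := norm_add_le (w ^ 2) ((a n ^ 2 : ℝ) : ℂ)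
  rw [norm_sub_rev, norm_mul, ha2] at h1
  rw [norm_pow, ha2] at h2
  nlinarith [mul_le_mul_of_nonneg_left hKw (sq_nonneg (a n)), sq_nonneg ‖w‖,
    mul_le_mul_of_nonneg_left hw.le (sq_nonneg (a n)), mul_le_mul_of_nonneg_right ha1 (sq_nonneg ‖w‖)]

theorem eventually_notMem_zerosEll (hA : IsPositiveWithCompactInverse A)
    (he : ∀ n, ∃ h : e n ∈ A.domain, A ⟨e n, h⟩ = (a n : ℂ) • e n) (ha : ∀ n, 1 ≤ a n)
    (ha_lim : Tendsto a atTop atTop) (hc : ∀ k, 0 < c k) (hcs : Summable c)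
    (hγ_lim : Tendsto γ atTop atTop) (hθ : θ ≤ 1) {z : ℂ} (hz : z ∈ resolventSetL A e a c γ θ) :
    ∀ᶠ w in 𝓝 z, ∀ n, w ∉ zerosEll a c γ θ n := by
  rcases hz with ⟨hzp, S, hS⟩ | ⟨hzp, C, hev⟩
  · obtain ⟨δ, hδ, h⟩ := exists_mul_sq_le_norm_ell ha ha_lim hθ
      (ell_ne_zero_of_isBoundedInverse hA he ha hθ hS) (by
        rintro rfl
        exact laplaceK_ne_one_of_isBoundedInverse hA he ha ha_lim hS)
    filter_upwards [eventually_ell_ne_zero ha hθ (fun k => (hc k).le) hcs hγ_lim hzp hδ h]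
      with w hw n hwn
    exact hw n hwn.2
  · rw [eventually_nhdsWithin_iff] at hev
    filter_upwards [hev] with w hw n hwn
    -- The punctured neighbourhood says nothing at the pole itself, but a pole is by definition not
    -- in `zerosEll`.
    rcases eq_or_ne w z with rfl | hne
    · exact hwn.1 hzp
    · obtain ⟨S, hS, -⟩ := hw hne
      exact ell_ne_zero_of_isBoundedInverse hA he ha hθ hS n hwn.2

/-- The spectrum of `L` is the closure of the set of zeros of the `ℓ_n`. -/
theorem spectrumL_eq_closure (hA : IsPositiveWithCompactInverse A)
    (he : ∀ n, ∃ h : e n ∈ A.domain, A ⟨e n, h⟩ = (a n : ℂ) • e n) (ha : ∀ n, 1 ≤ a n)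
    (ha_lim : Tendsto a atTop atTop) (hc : ∀ k, 0 < c k) (hcs : Summable c)
    (hγ_pos : ∀ k, 0 < γ k) (hγ_mono : StrictMono γ) (hγ_lim : Tendsto γ atTop atTop)
    (hs : Summable fun k => c k / γ k) (h1 : ∑' k, c k / γ k < 1) (hθ : θ ≤ 1)
    (hpoles : θ < 1 → poles γ ⊆ closure (⋃ n, zerosEll a c γ θ n)) :
    spectrumL A e a c γ θ = closure (⋃ n, zerosEll a c γ θ n) := by
  ext z
  rw [spectrumL, Set.mem_compl_iff]
  constructor
  · intro hz
    by_cases hzp : z ∈ poles γ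
    · rcases lt_or_eq_of_le hθ with h | rfl
      · exact hpoles h hzp
      · exact absurd (poles_subset_resolventSetL hA he ha hc hcs hγ_mono hγ_lim hzp) hz
    · by_cases hell : ∀ n, ell a c γ θ n z ≠ 0
      · by_cases hK : θ = 1 → laplaceK c γ z ≠ 1
        · obtain ⟨δ, hδ, h⟩ := exists_mul_sq_le_norm_ell ha ha_lim hθ hell hK
          obtain ⟨S, hS, -⟩ := exists_isBoundedInverse hA he ha hθ hδ h
          exact absurd (Or.inl ⟨hzp, S, hS⟩) hz
        · push Not at hK
          obtain ⟨rfl, hK⟩ := hK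
          exact mem_closure_of_laplaceK_eq_one ha ha_lim hc hcs hγ_pos hγ_lim hs h1 hzp hK
      · push Not at hell
        obtain ⟨n, hn⟩ := hell
        exact subset_closure (Set.mem_iUnion.2 ⟨n, hzp, hn⟩)
  · intro hz hres
    obtain ⟨w, hw, hwn⟩ := ((mem_closure_iff_frequently.1 hz).and_eventually
      (eventually_notMem_zerosEll hA he ha ha_lim hc hcs hγ_lim hθ hres)).exists
    obtain ⟨n, hn⟩ := Set.mem_iUnion.1 hw
    exact hwn n hn

end Spectrum

end GurtinPipkin

end

theorem mainTheorem4
    {H : Type*} [NormedAddCommGroup H] [InnerProductSpace ℂ H] [CompleteSpace H]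
    (A : H →ₗ.[ℂ] H) (hA : GurtinPipkin.IsPositiveWithCompactInverse A)
    (e : HilbertBasis ℕ ℂ H) (a : ℕ → ℝ)
    (he : ∀ n, ∃ h : e n ∈ A.domain, A ⟨e n, h⟩ = (a n : ℂ) • e n)
    (ha_mono : Monotone a) (ha_one : 1 ≤ a 0) (ha_lim : Tendsto a atTop atTop)
    (c γ : ℕ → ℝ) (hc : ∀ k, 0 < c k) (hγ_pos : ∀ k, 0 < γ k) (hγ_mono : StrictMono γ)
    (hγ_lim : Tendsto γ atTop atTop)
    (hγ_gap : ¬ BddAbove (Set.range fun k => γ k * (γ (k + 1) - γ k)))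
    (h_a_summable : Summable fun k => c k / γ k) (h_a : ∑' k, c k / γ k < 1)
    (h_b : Summable c)
    (θ : ℝ) (hθ : θ ∈ Set.Icc (0 : ℝ) 1) :
    ∃ (lam : ℕ → ℕ → ℝ) (lamPlus lamMinus : ℕ → ℂ),
      (∀ n, lam n 0 < 0) ∧
      (∀ n k, -γ k < lam n k) ∧
      (∀ n k, lam n (k + 1) < -γ k) ∧
      (θ < 1 → ∀ k, Tendsto (fun n => lam n k) atTop (𝓝 (-γ k))) ∧
      (∀ᶠ n in atTop, 0 < (lamPlus n).im ∧ lamMinus n = (starRingEnd ℂ) (lamPlus n)) ∧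
      (∀ n, GurtinPipkin.zerosEll a c γ θ n =
        (Set.range fun k => (lam n k : ℂ)) ∪ {lamPlus n, lamMinus n}) ∧
      GurtinPipkin.spectrumL A e a c γ θ =
        closure ((⋃ n, ⋃ k, {(lam n k : ℂ)}) ∪ (⋃ n, {lamPlus n, lamMinus n})) := by
  open GurtinPipkin in
  have ha : ∀ n, 1 ≤ a n := fun n => ha_one.trans (ha_mono n.zero_le)
  have ha0 : ∀ n, 0 < a n := fun n => one_pos.trans_le (ha n)
  have hβ : ∀ n, 0 < a n ^ (2 * θ) := fun n => Real.rpow_pos_of_pos (ha0 n) _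
  have hβα := rpow_two_mul_le ha hθ.2
  -- Indices start at `0`: `γ 0` is the first `γ`, and band `0` is the interval ending at `0`.
  choose lam p q hband hzeros hpq using fun n =>
    exists_zeroSet_eq hc h_b hγ_pos hγ_mono hγ_lim h_a_summable h_a (hβ n) (hβα n)
  have hlim : θ < 1 → ∀ k, Tendsto (fun n => lam n k) atTop (𝓝 (-γ k)) := fun hθ1 k =>
    tendsto_left_of_mem_band hc h_b hγ_mono hβ (tendsto_sq_div_rpow ha ha_lim hθ1)
      (fun n => hband n k) fun n => (ofReal_mem_zeroSet_iff.1 ((hzeros n).ge (Or.inl ⟨k, rfl⟩))).2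
  have hzeros' : ∀ n, zerosEll a c γ θ n = (Set.range fun k => (lam n k : ℂ)) ∪ {p n, q n} :=
    fun n => (zerosEll_eq ha c γ θ n).trans (hzeros n)
  refine ⟨lam, p, q, fun n => (hband n 0).2.1, fun n k => (hband n k).1,
    fun n k => (hband n (k + 1)).2.2 k k.lt_succ_self, hlim, ?_, hzeros', ?_⟩
  · filter_upwards [ha_lim.eventually_gt_atTop (8 * ∑' k, c k)] with n hn
    exact hpq n (exists_mem_zeroSet_im_pos (fun k => (hc k).le) h_b hγ_lim (ha0 n) hn (hβ n)
      (hβα n))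
  · have hU : (⋃ n, ⋃ k, {(lam n k : ℂ)}) ∪ (⋃ n, {p n, q n}) = ⋃ n, zerosEll a c γ θ n := by
      rw [← Set.iUnion_union_distrib]
      refine Set.iUnion_congr fun n => ?_
      rw [hzeros' n, Set.iUnion_singleton_eq_range]
    rw [hU]
    refine spectrumL_eq_closure hA he ha ha_lim hc h_b hγ_pos hγ_mono hγ_lim h_a_summable h_a hθ.2
      fun hθ1 => ?_
    -- For `θ < 1` the pole `-γ_k` is the limit of the zeros `lam n k` as `n → ∞`.
    rintro _ ⟨k, rfl⟩
    have h1 : Tendsto (fun n => (lam n k : ℂ)) atTop (𝓝 ((-γ k : ℝ) : ℂ)) :=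
      (Complex.continuous_ofReal.tendsto _).comp (hlim hθ1 k)
    rw [Complex.ofReal_neg] at h1
    refine mem_closure_of_tendsto h1 (Eventually.of_forall fun n => Set.mem_iUnion.2 ⟨n, ?_⟩)
    rw [hzeros' n]
    exact Or.inl ⟨k, rfl⟩
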